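/- Let $e:\mathbb{R}^2\to\mathbb{R}$, let $r\in\mathbb{N}$, and write $\mathcal F=\{\mathbf k\in\mathbb{R}^2 : e(\mathbf k)=0\}$. For $S\subset\mathbb R^2$ and $\mathbf q\in S$, a $C^{r-2}$ graph in $S$ at $\mathbf q$ over the first coordinate is a function $f$ of one real variable which is $C^{r-2}$ near $0$, with $f(0)=0$ and $(q_1+x,\,q_2+f(x))\in S$ for all $x$ near $0$; graphs over the second coordinate are defined by exchanging the roles of the coordinates. Assume: - **H1.** $\{\mathbf k : |e(\mathbf k)|\le 1\}$ is compact. - **H2.** $e$ is $C^r$ and $r\ge 7$. - **H3.** There are only finitely many points $\tilde{\mathbf k}$ (called singular points) with $e(\tilde{\mathbf k})=0$ and $\nabla e(\tilde{\mathbf k})=\mathbf 0$. - **H4.** At every singular point the Hessian matrix of $e$ is nonsingular and has one positive and one negative eigenvalue. - **H5.** For every $\tilde{\mathbf k}\in\mathcal F$ and every $C^{r-2}$ graph $f$ in $\mathcal F$ at $\tilde{\mathbf k}$ over either coordinate, there is $m$ with $2\le m\le r-2$ and $f^{(m)}(0)\ne0$. The least such $m$ is called a nonflatness order. - **H6.**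 For all $\tilde{\mathbf k}\ne\tilde{\mathbf p}$ in $\mathcal F$ and all $C^{r-2}$ graphs $f$ in $\mathcal F$ at $\tilde{\mathbf k}$ and $g$ in $\mathcal F$ at $\tilde{\mathbf p}$ over the same coordinate, there is $m\le r-2$ with $(f-g)^{(m)}(0)\ne 0$. If $e$ is not even, the same holds for all $\tilde{\mathbf k}\in\mathcal F$, all $\tilde{\mathbf p}\in-\mathcal F$ (the case $\tilde{\mathbf k}=\tilde{\mathbf p}$ included) and all $C^{r-2}$ graphs $f$ in $\mathcal F$ at $\tilde{\mathbf k}$ and $g$ in $-\mathcal F$ at $\tilde{\mathbf p}$ over the same coordinate. In each case the least such $m$ is called a nonnesting order. Let $n_0$ be one plus the largest nonflatness or nonnesting order ($n_0=1$ if there are none, i.e. if $\mathcal F=\emptyset$), and assume $r\ge 2n_0+1$. Let $M>1$. Then there is a constant $D>0$ such that for all $0<\delta<1$ and each choice of the sign $\pm$, the set of all $\mathbf p\in\mathbb{R}^2$ such that $$ \ell\big(\{\mathbf k\in\mathcal F : |e(\mathbf p\pm\mathbf k)|\le M^j\}\big)\ \ge\ \Big(\frac{M^j}{\delta}\Big)^{1/n_0}\qquad\text{for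 some real } j<0 $$ has Lebesgue measure at most $D\delta^2$. Here $\ell$ denotes arc length (one-dimensional Hausdorff measure). -/

import Mathlib

open scoped Topology

/-- The momentum plane `ℝ²` with its Euclidean norm. -/
abbrev Plane : Type := EuclideanSpace ℝ (Fin 2)

/-- The Fermi curve `{k | e k = 0}` of a dispersion relation `e`. -/
def fermiCurve (e : Plane → ℝ) : Set Plane := {k | e k = 0}

/-- The singular (Van Hove) points: points of the Fermi curve at which the gradient vanishes. -/
def singularPoints (e : Plane → ℝ) : Set Plane := {k | e k = 0 ∧ gradient e k = 0}

/-- The Hessian matrix of second partial derivatives of `e` at `k`. -/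
noncomputable def hessianMatrix (e : Plane → ℝ) (k : Plane) : Matrix (Fin 2) (Fin 2) ℝ :=
  Matrix.of fun i j =>
    iteratedFDeriv ℝ 2 e k ![EuclideanSpace.single i (1 : ℝ), EuclideanSpace.single j (1 : ℝ)]

/-- The vector whose `i`-th coordinate is `x` and whose other coordinate is `y`. -/
noncomputable def coordVec (i : Fin 2) (x y : ℝ) : Plane :=
  if i = 0 then !₂[x, y] else !₂[y, x]

/-- In a neighbourhood of its point `q`, the graph of `f`, written over the `i`-th coordinate and
centred at `q`, is a `C^n` curve contained in `S`. For `i = 0` this is the curve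
`k₂ - q₂ = f (k₁ - q₁)`; for `i = 1` the roles of the coordinates are exchanged. -/
def IsGraphIn (S : Set Plane) (n : ℕ) (q : Plane) (i : Fin 2) (f : ℝ → ℝ) : Prop :=
  ContDiffAt ℝ (n : WithTop ℕ∞) f 0 ∧ f 0 = 0 ∧ ∀ᶠ x in 𝓝 (0 : ℝ), q + coordVec i x (f x) ∈ S

/-- `f` describes a `C^(r-2)` piece of the Fermi curve through one of its points. -/
def IsFermiGraph (e : Plane → ℝ) (r : ℕ) (f : ℝ → ℝ) : Prop :=
  ∃ k ∈ fermiCurve e, ∃ i : Fin 2, IsGraphIn (fermiCurve e) (r - 2) k i f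

/-- The pairs `f`, `g` compared in the nesting condition: `C^(r-2)` pieces, written over the same
coordinate, of the Fermi curve `F` at two distinct points of `F`, or, if `e` is not even, of `F` at
any point of `F` and of the reflected curve `-F` at any point of `-F`. -/
def IsNestingPair (e : Plane → ℝ) (r : ℕ) (f g : ℝ → ℝ) : Prop :=
  (∃ k ∈ fermiCurve e, ∃ p ∈ fermiCurve e, k ≠ p ∧ ∃ i : Fin 2,
      IsGraphIn (fermiCurve e) (r - 2) k i f ∧ IsGraphIn (fermiCurve e) (r - 2) p i g) ∨
  (¬ Function.Even e ∧
    ∃ k ∈ fermiCurve e, ∃ p ∈ {q : Plane | -q ∈ fermiCurve e}, ∃ i : Fin 2,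
      IsGraphIn (fermiCurve e) (r - 2) k i f ∧
      IsGraphIn {q : Plane | -q ∈ fermiCurve e} (r - 2) p i g)

/-- The orders `n` with `a ≤ n ≤ r - 2` at which the derivative of `h` at `0` does not vanish. -/
def nonvanishingOrders (r a : ℕ) (h : ℝ → ℝ) : Set ℕ :=
  {n | a ≤ n ∧ n ≤ r - 2 ∧ iteratedDeriv n h 0 ≠ 0}

/-- H1: the set `{|e| ≤ 1}` is compact. -/
def HypH1 (e : Plane → ℝ) : Prop := IsCompact {k : Plane | |e k| ≤ 1}

/-- H2: `e` is `C^r` with `r ≥ 7`. -/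
def HypH2 (e : Plane → ℝ) (r : ℕ) : Prop := 7 ≤ r ∧ ContDiff ℝ (r : WithTop ℕ∞) e

/-- H3: there are only finitely many singular points. -/
def HypH3 (e : Plane → ℝ) : Prop := (singularPoints e).Finite

/-- H4: at each singular point the Hessian is nonsingular, with one positive and one negative
eigenvalue. -/
def HypH4 (e : Plane → ℝ) : Prop :=
  ∀ k ∈ singularPoints e, (hessianMatrix e k).det ≠ 0 ∧
    (∃ a : ℝ, 0 < a ∧ Module.End.HasEigenvalue (Matrix.toLin' (hessianMatrix e k)) a) ∧
    (∃ b : ℝ, b < 0 ∧ Module.End.HasEigenvalue (Matrix.toLin' (hessianMatrix e k)) b)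

/-- H5: at worst polynomial flatness. -/
def HypH5 (e : Plane → ℝ) (r : ℕ) : Prop :=
  ∀ f : ℝ → ℝ, IsFermiGraph e r f → (nonvanishingOrders r 2 f).Nonempty

/-- H6: at worst polynomial nesting. -/
def HypH6 (e : Plane → ℝ) (r : ℕ) : Prop :=
  ∀ f g : ℝ → ℝ, IsNestingPair e r f g →
    (nonvanishingOrders r 0 fun x => f x - g x).Nonempty

/-- The nonflatness orders: the first nonvanishing orders, at least two, of pieces of the Fermi
curve. -/
def flatnessOrders (e : Plane → ℝ) (r : ℕ) : Set ℕ :=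
  {m | ∃ f : ℝ → ℝ, IsFermiGraph e r f ∧ IsLeast (nonvanishingOrders r 2 f) m}

/-- The nonnesting orders: the first nonvanishing orders of differences of nesting pairs. -/
def nestingOrders (e : Plane → ℝ) (r : ℕ) : Set ℕ :=
  {m | ∃ f g : ℝ → ℝ, IsNestingPair e r f g ∧
    IsLeast (nonvanishingOrders r 0 fun x => f x - g x) m}

/-- `n₀`: the largest nonflatness or nonnesting order, plus one. All orders are at most `r - 2`,
so the supremum is a maximum unless the Fermi curve is empty (then `n₀ = 1`). -/
noncomputable def flatNestIndex (e : Plane → ℝ) (r : ℕ) : ℕ :=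
  sSup (flatnessOrders e r ∪ nestingOrders e r) + 1

/-! Write `F` for the Fermi curve, contained in a disc of radius `R`. Everything rests on one bound:
for `0 < |p| ≤ 2R` and `ε > 0`, the length of `{k ∈ F : |e (p ± k)| ≤ ε}` is at most `C
(ε/|p|)^(1/n₀)`. If this length is also at least `(ε/δ)^(1/n₀)`, then `|p| ≤ C^n₀ δ`, so the
exceptional set lies in a disc of area `π C^(2n₀) δ²`. For larger `p` and `ε ≤ 1` the set of `k` is
empty.

By compactness the bound is local in `p` and `k`. The blow-up `(x, u) ↦ q + (x, xu)` turns `e` into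
`x^N G(x, u)`, with `N = 1` at regular points and `N = 2` at singular ones, where `G(0, ·)` has only
simple roots (`hasBlowup_of_mem_fermiCurve`). Hence `F` near `q` consists of `q` and finitely many
graphs `γ` (`exists_finite_graphs`). On a graph, a one-variable sublevel estimate
(`exists_uniform_volume_sublevel_le`) gives the exponent `1/n₀` once some derivative of order at
most `n₀` is nonzero.

Near `p₀ ≠ 0`, suppose `e (p₀ + γ x)` vanished beyond order `n₀`. Then `γ` would agree through order
`n₀ - 1` with a branch of the zero set at `p₀ + q`, against H6. One order is lost where branches
cross, hence the "plus one" in `n₀`. Near `p = 0`, `e (p + γ x)` is `|p|` times an averaged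
derivative of `e` in the direction `p/|p|`, and H5 limits how far directional derivatives vanish
along `γ`; this is the source of the factor `1/|p|`. The minus sign is the same problem for `k ↦ e
(-k)`, settled by evenness or by the second half of H6. -/

/-! ### Taylor expansion and order of vanishing -/

theorem ContDiffAt.deriv_of_succ {h : ℝ → ℝ} {m : ℕ} {x : ℝ}
    (hh : ContDiffAt ℝ (m + 1 : ℕ) h x) : ContDiffAt ℝ m (deriv h) x := by
  have := (hh.fderiv_right (m := m) (by norm_cast)).clm_apply (contDiffAt_const (c := (1 : ℝ)))
  exact this

open Asymptotics in
theorem ContDiffAt.isLittleO_sub_taylor {φ : ℝ → ℝ} {n : ℕ} (hφ : ContDiffAt ℝ n φ 0) :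
    (fun x => φ x - ∑ k ∈ Finset.range (n + 1), ((k.factorial : ℝ)⁻¹ * x ^ k) * iteratedDeriv k φ 0)
      =o[𝓝 0] fun x => x ^ n := by
  obtain ⟨u, hu, h0, hcd⟩ := hφ.contDiffOn' (m := n) le_rfl (by simp)
  obtain ⟨ρ, hρ, hball⟩ := Metric.isOpen_iff.1 hu 0 h0
  have hs : ContDiffOn ℝ n φ (Metric.ball 0 ρ) := hcd.mono (by simpa using hball)
  have h0' : (0 : ℝ) ∈ Metric.ball (0 : ℝ) ρ := Metric.mem_ball_self hρ
  have := taylor_isLittleO (convex_ball 0 ρ) h0' hs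
  rw [Metric.isOpen_ball.nhdsWithin_eq h0'] at this
  simp only [taylor_within_apply, sub_zero, smul_eq_mul] at this
  simpa only [iteratedDerivWithin_of_isOpen Metric.isOpen_ball h0'] using this

open Filter Asymptotics in
theorem isLittleO_pow_of_iteratedDeriv_eq_zero {φ : ℝ → ℝ} {n : ℕ} (hφ : ContDiffAt ℝ n φ 0)
    (h : ∀ m ≤ n, iteratedDeriv m φ 0 = 0) : φ =o[𝓝 0] fun x => x ^ n := by
  have := hφ.isLittleO_sub_taylor
  rwa [show (fun x => φ x - ∑ k ∈ Finset.range (n + 1),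
    ((k.factorial : ℝ)⁻¹ * x ^ k) * iteratedDeriv k φ 0) = φ from ?_] at this
  ext x
  rw [Finset.sum_eq_zero, sub_zero]
  intro k hk
  rw [h k (by simpa [Nat.lt_succ_iff] using hk), mul_zero]

-- By strong induction the first possibly nonzero Taylor term is a multiple of `x ^ m` that is `o(x
-- ^ m)`, so its coefficient is zero.
open Filter Asymptotics in
theorem iteratedDeriv_eq_zero_of_isLittleO_pow {φ : ℝ → ℝ} {n : ℕ} (hφ : ContDiffAt ℝ n φ 0)
    (h : φ =o[𝓝 0] fun x => x ^ n) : ∀ m ≤ n, iteratedDeriv m φ 0 = 0 := by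
  intro m
  induction m using Nat.strong_induction_on with
  | _ m ih =>
    intro hm
    have h1 := (hφ.of_le (by exact_mod_cast hm : (m : WithTop ℕ∞) ≤ n)).isLittleO_sub_taylor
    have h2 : φ =o[𝓝 0] fun x => x ^ m := h.trans_isBigO (by
      refine IsBigO.of_bound 1 ?_
      filter_upwards [Metric.ball_mem_nhds (0 : ℝ) one_pos] with x hx
      rw [one_mul, norm_pow, norm_pow]
      exact pow_le_pow_of_le_one (norm_nonneg _) (by simpa using (mem_ball_zero_iff.1 hx).le) hm)
    have h3 := h2.sub h1
    have h4 : (fun x : ℝ => ((m.factorial : ℝ)⁻¹ * iteratedDeriv m φ 0) * x ^ m)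
        =o[𝓝 0] fun x => x ^ m := by
      refine h3.congr_left fun x => ?_
      rw [Finset.sum_range_succ, Finset.sum_eq_zero]
      · ring
      · intro k hk
        rw [ih k (by simpa using hk) ((by simpa using hk : k < m).le.trans hm), mul_zero]
    by_contra hne
    have hc : ((m.factorial : ℝ)⁻¹ * iteratedDeriv m φ 0) ≠ 0 :=
      mul_ne_zero (inv_ne_zero (by exact_mod_cast m.factorial_ne_zero)) hne
    rw [isLittleO_const_mul_left_iff hc] at h4
    have h5 := h4.mono (nhdsWithin_le_nhds (s := {0}ᶜ))
    have h6 := isLittleO_irrefl (f'' := fun x : ℝ => x ^ m) (l := 𝓝[≠] (0 : ℝ)) (by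
      apply Eventually.frequently
      filter_upwards [self_mem_nhdsWithin] with x hx
      exact pow_ne_zero _ hx)
    exact h6 h5

/-! ### Sublevel estimates in one variable -/

/-- The mean value theorem on the disjoint pairs `x (2i)`, `x (2i+1)` yields half as many points
where `|h'| ≤ 2ε/s`. The gap between consecutive pairs keeps these points `s`-separated, so the
induction continues with `deriv h`. -/
theorem exists_abs_iteratedDeriv_le_of_separated (m : ℕ) :
    ∀ (h : ℝ → ℝ) (I : Set ℝ), I.OrdConnected → (∀ x ∈ I, ContDiffAt ℝ m h x) →
    ∀ (s ε : ℝ), 0 < s → ∀ x : ℕ → ℝ, (∀ i < 2 ^ m, x i ∈ I ∧ |h (x i)| ≤ ε) →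
    (∀ i, i + 1 < 2 ^ m → x i + s ≤ x (i + 1)) →
    ∃ ξ ∈ I, |iteratedDeriv m h ξ| ≤ ε * (2 / s) ^ m := by
  induction m with
  | zero =>
    intro h I _ _ s ε _ x hx _
    exact ⟨x 0, (hx 0 (by simp)).1, by simpa using (hx 0 (by simp)).2⟩
  | succ m ih =>
    intro h I hI hh s ε hs x hx hsep
    have hdiff : ∀ y ∈ I, DifferentiableAt ℝ h y := fun y hy => (hh y hy).differentiableAt (by simp)
    have key : ∀ i, i < 2 ^ m → ∃ ξ, x (2 * i) < ξ ∧ ξ < x (2 * i + 1) ∧ ξ ∈ I ∧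
        |deriv h ξ| ≤ ε * (2 / s) := by
      intro i hi
      have hi1 : 2 * i + 1 < 2 ^ (m + 1) := by rw [pow_succ]; omega
      have ha := hx (2 * i) (by omega)
      have hb := hx (2 * i + 1) hi1
      have hgap := hsep (2 * i) hi1
      have hlt : x (2 * i) < x (2 * i + 1) := by linarith
      have hsub : Set.Icc (x (2 * i)) (x (2 * i + 1)) ⊆ I := hI.out ha.1 hb.1
      obtain ⟨ξ, hξ, he⟩ := exists_deriv_eq_slope h hlt
        (fun y hy => (hdiff y (hsub hy)).continuousAt.continuousWithinAt)
        (fun y hy => (hdiff y (hsub (Set.Ioo_subset_Icc_self hy))).differentiableWithinAt)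
      refine ⟨ξ, hξ.1, hξ.2, hsub (Set.Ioo_subset_Icc_self hξ), ?_⟩
      have hε : 0 ≤ ε := (abs_nonneg _).trans ha.2
      rw [he, abs_div, abs_of_pos (sub_pos.2 hlt)]
      calc |h (x (2 * i + 1)) - h (x (2 * i))| / (x (2 * i + 1) - x (2 * i))
          ≤ (ε + ε) / s := by
            gcongr
            · exact (abs_sub _ _).trans (add_le_add hb.2 ha.2)
            · linarith
        _ = ε * (2 / s) := by ring
    choose! ξ h1 h2 h3 h4 using key
    obtain ⟨z, hz, hz'⟩ := ih (deriv h) I hI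
      (fun y hy => (hh y hy).deriv_of_succ) s (ε * (2 / s)) hs ξ
      (fun i hi => ⟨h3 i hi, h4 i hi⟩) (fun i hi => by
        have hs' := hsep (2 * i + 1) (by rw [pow_succ]; omega)
        have := h2 i (by omega)
        have := h1 (i + 1) hi
        rw [show 2 * (i + 1) = 2 * i + 1 + 1 by ring] at this
        linarith)
    exact ⟨z, hz, by rw [iteratedDeriv_succ', pow_succ']; simpa [mul_assoc] using hz'⟩

-- Greedy choice: a point `x0` of `A` within `s` of `sInf A` is kept, and discarding everything
-- below `x0 + s` costs measure at most `2 * s`.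
open MeasureTheory in
theorem exists_separated_of_lt_volume (N : ℕ) {s : ℝ} (hs : 0 < s) :
    ∀ A : Set ℝ, BddBelow A → ENNReal.ofReal (2 * s * N) < volume A →
    ∃ x : ℕ → ℝ, (∀ i < N, x i ∈ A) ∧ ∀ i, i + 1 < N → x i + s ≤ x (i + 1) := by
  induction N with
  | zero => intro A _ _; exact ⟨fun _ => 0, by simp, by simp⟩
  | succ N ih =>
    intro A hA hvol
    have hne : A.Nonempty := by
      rw [Set.nonempty_iff_ne_empty]; rintro rfl; simp at hvol
    obtain ⟨x0, hx0, hlt⟩ := exists_lt_of_csInf_lt hne (lt_add_of_pos_right (sInf A) hs)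
    have hsub : A ⊆ (A ∩ Set.Ici (x0 + s)) ∪ Set.Icc (sInf A) (x0 + s) := by
      intro y hy
      rcases le_total (x0 + s) y with h | h
      · exact Or.inl ⟨hy, h⟩
      · exact Or.inr ⟨csInf_le hA hy, h⟩
    have hvol' : ENNReal.ofReal (2 * s * N) < volume (A ∩ Set.Ici (x0 + s)) := by
      by_contra hcon
      push Not at hcon
      refine absurd hvol (not_lt.2 ?_)
      calc volume A ≤ volume (A ∩ Set.Ici (x0 + s)) + volume (Set.Icc (sInf A) (x0 + s)) :=
            (measure_mono hsub).trans (measure_union_le _ _)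
        _ ≤ ENNReal.ofReal (2 * s * N) + ENNReal.ofReal (2 * s) := by
            gcongr
            rw [Real.volume_Icc]
            exact ENNReal.ofReal_le_ofReal (by linarith)
        _ = _ := by
            rw [← ENNReal.ofReal_add (by positivity) (by positivity)]
            congr 1; push_cast; ring
    obtain ⟨y, hy1, hy2⟩ := ih _ (hA.mono Set.inter_subset_left) hvol'
    refine ⟨fun i => Nat.casesOn i x0 y, ?_, ?_⟩
    · rintro (_ | i) hi
      · exact hx0
      · exact (hy1 i (by omega)).1
    · rintro (_ | i) hi
      · exact (hy1 0 (by omega)).2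
      · exact hy2 i (by omega)

-- A larger set would contain `2 ^ m` points with spacing `s = 3 (ε/c)^(1/m)`, forcing the `m`-th
-- derivative down to `ε (2/s)^m = c (2/3)^m < c` somewhere. The factor 6 is twice this 3.
open MeasureTheory in
theorem volume_sublevel_le {h : ℝ → ℝ} {I : Set ℝ} (hI : I.OrdConnected) (hb : BddBelow I) {m : ℕ}
    (hm : m ≠ 0) (hh : ∀ x ∈ I, ContDiffAt ℝ m h x) {c : ℝ} (hc : 0 < c)
    (hder : ∀ x ∈ I, c ≤ |iteratedDeriv m h x|) {ε : ℝ} (hε : 0 < ε) :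
    volume {x | x ∈ I ∧ |h x| ≤ ε} ≤ ENNReal.ofReal (6 * 2 ^ m * (ε / c) ^ (1 / m : ℝ)) := by
  by_contra hcon
  push Not at hcon
  have hpos : 0 < ε / c := by positivity
  set s : ℝ := 3 * (ε / c) ^ (1 / m : ℝ) with hs
  have hs0 : 0 < s := by positivity
  obtain ⟨x, hx, hsep⟩ := exists_separated_of_lt_volume (2 ^ m) hs0 _
    (hb.mono (Set.sep_subset I _)) (by
      convert! hcon using 2
      push_cast; rw [hs]; ring)
  obtain ⟨ξ, hξ, hle⟩ := exists_abs_iteratedDeriv_le_of_separated m h I hI hh s ε hs0 x hx hsep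
  have h1 := (hder ξ hξ).trans hle
  have h2 : s ^ m = 3 ^ m * (ε / c) := by
    rw [hs, mul_pow, ← Real.rpow_natCast ((ε / c) ^ (1 / m : ℝ)), ← Real.rpow_mul hpos.le,
      one_div_mul_cancel (by exact_mod_cast hm), Real.rpow_one]
  rw [div_pow, h2] at h1
  have h3 : ε * (2 ^ m / (3 ^ m * (ε / c))) = c * (2 / 3) ^ m := by
    rw [div_pow]; field_simp
  rw [h3] at h1
  have h4 : ((2 : ℝ) / 3) ^ m < 1 := pow_lt_one₀ (by norm_num) (by norm_num) hm
  nlinarith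

open Filter in
theorem continuousAt_iteratedDeriv_snd {Λ : Type*} [NormedAddCommGroup Λ] [NormedSpace ℝ Λ]
    (m : ℕ) : ∀ (h : Λ × ℝ → ℝ) (z : Λ × ℝ), ContDiffAt ℝ m h z →
    ContinuousAt (fun z : Λ × ℝ => iteratedDeriv m (fun x => h (z.1, x)) z.2) z := by
  induction m with
  | zero => intro h z hh; simpa using hh.continuousAt
  | succ m ih =>
    intro h z hh
    have h1 : ContDiffAt ℝ m (fun w => fderiv ℝ h w (0, 1)) z :=
      (hh.fderiv_right (m := m) (by norm_cast)).clm_apply contDiffAt_const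
    refine (ih _ z h1).congr ?_
    have h2 : ∀ᶠ w in 𝓝 z, DifferentiableAt ℝ h w := by
      filter_upwards [hh.eventually (by simp)] with w hw using hw.differentiableAt (by simp)
    filter_upwards [h2.eventually_nhds] with w hw
    rw [iteratedDeriv_succ']
    refine (EventuallyEq.iteratedDeriv_eq m ?_)
    have hcont : Tendsto (fun x : ℝ => (w.1, x)) (𝓝 w.2) (𝓝 w) :=
      (Continuous.prodMk_right w.1).tendsto w.2
    filter_upwards [hcont.eventually hw] with x hx
    have hd : HasDerivAt (fun x : ℝ => (w.1, x)) ((0 : Λ), (1 : ℝ)) x :=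
      (hasDerivAt_const x w.1).prodMk (hasDerivAt_id x)
    exact (hx.hasFDerivAt.comp_hasDerivAt x hd).deriv.symm

-- Joint continuity keeps the `m`-th derivative above half its value at `(l0, 0)` on a whole
-- neighbourhood, so a single constant serves all nearby parameters.
open Filter MeasureTheory in
theorem exists_uniform_volume_sublevel_le {Λ : Type*} [NormedAddCommGroup Λ] [NormedSpace ℝ Λ]
    {h : Λ × ℝ → ℝ} {l0 : Λ} {n m : ℕ} (hmn : m ≤ n) (hn : n ≠ 0) (hh : ContDiffAt ℝ n h (l0, 0))
    (hm : iteratedDeriv m (fun x => h (l0, x)) 0 ≠ 0) :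
    ∃ η > 0, ∃ C > 0, ∀ᶠ l in 𝓝 l0, ∀ ε > 0,
      volume {x | x ∈ Set.Ioo (-η) η ∧ |h (l, x)| ≤ ε} ≤
        ENNReal.ofReal (C * ε ^ (1 / n : ℝ)) := by
  have hhm : ContDiffAt ℝ m h (l0, 0) := hh.of_le (by exact_mod_cast hmn)
  set c := |iteratedDeriv m (fun x => h (l0, x)) 0| / 2 with hc
  have hc0 : 0 < c := by have := abs_pos.2 hm; positivity
  have hev : ∀ᶠ z in 𝓝 (l0, (0 : ℝ)), c ≤ |iteratedDeriv m (fun x => h (z.1, x)) z.2| ∧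
      ContDiffAt ℝ m h z := by
    refine Filter.Eventually.and ?_ (hhm.eventually (by simp))
    have := (continuousAt_iteratedDeriv_snd m h _ hhm).abs
    refine (this.eventually (lt_mem_nhds (a := c) ?_)).mono fun _ h => h.le
    have := abs_pos.2 hm
    simp only [hc]; linarith
  rw [nhds_prod_eq] at hev
  obtain ⟨pa, ha, pb, hb, hab⟩ := Filter.eventually_prod_iff.1 hev
  obtain ⟨η, hη, hball⟩ := Metric.eventually_nhds_iff_ball.1 hb
  have hI : ∀ x ∈ Set.Ioo (-η) η, pb x := fun x hx =>
    hball x (by rw [mem_ball_zero_iff, Real.norm_eq_abs, abs_lt]; exact hx)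
  have hpow0 : 0 < c ^ (1 / n : ℝ) := by positivity
  -- The three terms serve `ε ≥ 1`, then `m = 0` with `c ≤ ε ≤ 1`, then `m > 0` with `ε ≤ 1`, where
  -- the exponent `1/m` may be lowered to `1/n`.
  set C : ℝ := 2 * η + 2 * η / c ^ (1 / n : ℝ) + 6 * 2 ^ m * (1 / c) ^ (1 / m : ℝ) with hC
  have hb1 : 0 < 2 * η / c ^ (1 / n : ℝ) := by positivity
  have hb2 : 0 < 6 * 2 ^ m * (1 / c) ^ (1 / m : ℝ) := by positivity
  have hC1 : 2 * η / c ^ (1 / n : ℝ) ≤ C := by rw [hC]; linarith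
  refine ⟨η, hη, C, by positivity, ?_⟩
  filter_upwards [ha] with l hl ε hε
  have hvol : volume {x | x ∈ Set.Ioo (-η) η ∧ |h (l, x)| ≤ ε} ≤ ENNReal.ofReal (2 * η) := by
    refine (measure_mono (Set.sep_subset _ _)).trans ?_
    rw [Real.volume_Ioo]
    exact ENNReal.ofReal_le_ofReal (by linarith)
  have hεn : 0 < ε ^ (1 / n : ℝ) := by positivity
  rcases le_total 1 ε with h1 | h1
  · refine hvol.trans (ENNReal.ofReal_le_ofReal ?_)
    have : 1 ≤ ε ^ (1 / n : ℝ) := Real.one_le_rpow h1 (by positivity)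
    nlinarith
  rcases Nat.eq_zero_or_pos m with rfl | hmpos
  · rcases lt_or_ge ε c with h2 | h2
    · rw [show {x | x ∈ Set.Ioo (-η) η ∧ |h (l, x)| ≤ ε} = ∅ from ?_]
      · simp
      · refine Set.eq_empty_of_forall_notMem fun x hmem => ?_
        obtain ⟨hx, hle⟩ := hmem
        have := (hab hl (hI x hx)).1
        simp only [iteratedDeriv_zero] at this
        linarith
    · refine hvol.trans (ENNReal.ofReal_le_ofReal ?_)
      have h3 : c ^ (1 / n : ℝ) ≤ ε ^ (1 / n : ℝ) := by gcongr
      have h4 : 2 * η ≤ 2 * η / c ^ (1 / n : ℝ) * ε ^ (1 / n : ℝ) := by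
        rw [div_mul_eq_mul_div, le_div_iff₀ hpow0]
        gcongr
      exact h4.trans (mul_le_mul_of_nonneg_right hC1 hεn.le)
  · have hcd : ∀ x ∈ Set.Ioo (-η) η, ContDiffAt ℝ m (fun x => h (l, x)) x := fun x hx =>
      (hab hl (hI x hx)).2.comp x (contDiffAt_const.prodMk contDiffAt_id)
    refine (volume_sublevel_le Set.ordConnected_Ioo bddBelow_Ioo hmpos.ne' hcd hc0
      (fun x hx => (hab hl (hI x hx)).1) hε).trans (ENNReal.ofReal_le_ofReal ?_)
    have h3 : ε ^ (1 / m : ℝ) ≤ ε ^ (1 / n : ℝ) := by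
      apply Real.rpow_le_rpow_of_exponent_ge hε h1
      gcongr
    rw [div_eq_mul_one_div ε c, Real.mul_rpow hε.le (by positivity)]
    calc 6 * 2 ^ m * (ε ^ (1 / m : ℝ) * (1 / c) ^ (1 / m : ℝ))
        = 6 * 2 ^ m * (1 / c) ^ (1 / m : ℝ) * ε ^ (1 / m : ℝ) := by ring
      _ ≤ C * ε ^ (1 / n : ℝ) := by
        gcongr
        rw [hC]; linarith

/-! ### Integrals depending on a parameter -/

open Filter MeasureTheory in
theorem hasFDerivAt_intervalIntegral_param {P W : Type*} [NormedAddCommGroup P] [NormedSpace ℝ P]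
    [ProperSpace P] [NormedAddCommGroup W] [NormedSpace ℝ W] {F : P × ℝ → W}
    (hF : ContDiff ℝ 1 F) (p : P) :
    HasFDerivAt (fun p => ∫ t in (0 : ℝ)..1, F (p, t))
      (∫ t in (0 : ℝ)..1, (fderiv ℝ F (p, t)).comp (.inl ℝ P ℝ)) p := by
  have hcont : Continuous fun z : P × ℝ => (fderiv ℝ F z).comp (ContinuousLinearMap.inl ℝ P ℝ) :=
    (hF.continuous_fderiv (by simp)).clm_comp continuous_const
  obtain ⟨C, hC⟩ := ((isCompact_closedBall p 1).prod (isCompact_Icc (a := (0 : ℝ)) (b := 1))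
    |>.bddAbove_image (f := fun z : P × ℝ => ‖(fderiv ℝ F z).comp (.inl ℝ P ℝ)‖)
      hcont.norm.continuousOn)
  refine intervalIntegral.hasFDerivAt_integral_of_dominated_of_fderiv_le
    (F := fun p t => F (p, t)) (F' := fun p t => (fderiv ℝ F (p, t)).comp (.inl ℝ P ℝ))
    (bound := fun _ => C) (Metric.closedBall_mem_nhds p one_pos) ?_ ?_ ?_ ?_ ?_ ?_
  · exact Eventually.of_forall fun q =>
      (hF.continuous.comp (Continuous.prodMk_right q)).aestronglyMeasurable
  · exact (hF.continuous.comp (Continuous.prodMk_right p)).intervalIntegrable _ _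
  · exact (hcont.comp (Continuous.prodMk_right p)).aestronglyMeasurable
  · refine Eventually.of_forall fun t ht q hq => hC ⟨(q, t), ⟨hq, ?_⟩, rfl⟩
    rw [Set.uIoc_of_le zero_le_one] at ht
    exact Set.Ioc_subset_Icc_self ht
  · exact continuous_const.intervalIntegrable _ _
  · refine Eventually.of_forall fun t _ q _ => ?_
    have h1 : HasFDerivAt (fun q : P => (q, t)) (ContinuousLinearMap.inl ℝ P ℝ) q :=
      hasFDerivAt_prodMk_left q t
    exact ((hF.differentiable (by simp)) (q, t)).hasFDerivAt.comp q h1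

/-- The induction on `n` replaces `W` by `P →L[ℝ] W`, so `W` is quantified after `n` and shares the
universe of `P`. -/
theorem contDiff_intervalIntegral_param.{u} {P : Type u} [NormedAddCommGroup P] [NormedSpace ℝ P]
    [ProperSpace P] (n : ℕ) : ∀ {W : Type u} [NormedAddCommGroup W] [NormedSpace ℝ W]
    {F : P × ℝ → W}, ContDiff ℝ n F →
    ContDiff ℝ n fun p => ∫ t in (0 : ℝ)..1, F (p, t) := by
  induction n with
  | zero =>
    intro W _ _ F hF
    simp only [Nat.cast_zero, contDiff_zero] at hF ⊢
    exact intervalIntegral.continuous_parametric_intervalIntegral_of_continuous'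
      (f := fun p t => F (p, t)) hF 0 1
  | succ n ih =>
    intro W _ _ F hF
    have h1 : ContDiff ℝ 1 F := hF.of_le (by norm_cast; omega)
    rw [Nat.cast_add, Nat.cast_one, contDiff_succ_iff_fderiv]
    refine ⟨fun p => (hasFDerivAt_intervalIntegral_param h1 p).differentiableAt, by simp, ?_⟩
    rw [funext fun p => (hasFDerivAt_intervalIntegral_param h1 p).fderiv]
    exact ih (F := fun z => (fderiv ℝ F z).comp (.inl ℝ P ℝ))
      ((hF.fderiv_right (by norm_cast)).clm_comp contDiff_const)

/-! ### Coordinates and averaged derivatives -/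

theorem coordVec_eq (i : Fin 2) (x y : ℝ) :
    coordVec i x y = x • coordVec i 1 0 + y • coordVec i 0 1 := by
  fin_cases i <;> ext j <;> fin_cases j <;> simp [coordVec]

theorem coordVec_mul (i : Fin 2) (a x y : ℝ) : coordVec i (a * x) (a * y) = a • coordVec i x y := by
  fin_cases i <;> ext j <;> fin_cases j <;> simp [coordVec]

theorem exists_eq_coordVec (i : Fin 2) (w : Plane) : ∃ x y, w = coordVec i x y := by
  fin_cases i
  · exact ⟨w 0, w 1, by ext j; fin_cases j <;> simp [coordVec]⟩
  · exact ⟨w 1, w 0, by ext j; fin_cases j <;> simp [coordVec]⟩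

theorem coordVec_apply_self (i : Fin 2) (x y : ℝ) : coordVec i x y i = x := by
  fin_cases i <;> simp [coordVec]

theorem coordVec_zero (i : Fin 2) : coordVec i 0 0 = 0 := by
  rw [coordVec_eq]; simp

theorem coordVec_one_ne_zero (i : Fin 2) (u : ℝ) : coordVec i 1 u ≠ 0 := by
  intro h
  have := congrArg (fun w : Plane => w i) h
  simp [coordVec_apply_self] at this

theorem ContDiffAt.coordVec {V : Type*} [NormedAddCommGroup V] [NormedSpace ℝ V] {n : WithTop ℕ∞}
    {f g : V → ℝ} {v : V} (i : Fin 2) (hf : ContDiffAt ℝ n f v) (hg : ContDiffAt ℝ n g v) :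
    ContDiffAt ℝ n (fun v => _root_.coordVec i (f v) (g v)) v := by
  simp only [coordVec_eq i (f _)]
  exact (hf.smul contDiffAt_const).add (hg.smul contDiffAt_const)

theorem ContDiff.coordVec {V : Type*} [NormedAddCommGroup V] [NormedSpace ℝ V] {n : WithTop ℕ∞}
    {f g : V → ℝ} (i : Fin 2) (hf : ContDiff ℝ n f) (hg : ContDiff ℝ n g) :
    ContDiff ℝ n (fun v => _root_.coordVec i (f v) (g v)) :=
  contDiff_iff_contDiffAt.2 fun _ => hf.contDiffAt.coordVec i hg.contDiffAt

theorem HasDerivAt.coordVec {f g : ℝ → ℝ} {f' g' x : ℝ} (i : Fin 2) (hf : HasDerivAt f f' x)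
    (hg : HasDerivAt g g' x) :
    HasDerivAt (fun x => _root_.coordVec i (f x) (g x)) (_root_.coordVec i f' g') x := by
  simp only [coordVec_eq i (f _), coordVec_eq i f']
  exact (hf.smul_const _).add (hg.smul_const _)

/-- The averaged directional derivative: `e (y + ρ • w) = e y + ρ * lineAverage e (y, ρ, w)`. -/
noncomputable def lineAverage (e : Plane → ℝ) (z : Plane × ℝ × Plane) : ℝ :=
  ∫ t in (0 : ℝ)..1, fderiv ℝ e (z.1 + t • z.2.1 • z.2.2) z.2.2

theorem contDiff_lineAverage {e : Plane → ℝ} {n : ℕ} (he : ContDiff ℝ (n + 1 : ℕ) e) :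
    ContDiff ℝ n (lineAverage e) := by
  refine contDiff_intervalIntegral_param n
    (F := fun z : (Plane × ℝ × Plane) × ℝ =>
      fderiv ℝ e (z.1.1 + z.2 • z.1.2.1 • z.1.2.2) z.1.2.2) ?_
  have h1 : ContDiff ℝ n (fderiv ℝ e) := he.fderiv_right (by norm_cast)
  exact (h1.comp (by fun_prop)).clm_apply (by fun_prop)

theorem apply_add_eq_lineAverage {e : Plane → ℝ} (he : ContDiff ℝ 1 e) (y : Plane) (ρ : ℝ)
    (w : Plane) : e (y + ρ • w) = e y + ρ * lineAverage e (y, ρ, w) := by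
  have := map_add_eq_sum_add_integral_iteratedFDeriv (f := e) (x := y) (y := ρ • w) (n := 0)
    (fun t _ => by simpa using he.contDiffAt)
  simpa [lineAverage, iteratedFDeriv_one_apply] using this

theorem lineAverage_zero (e : Plane → ℝ) (y w : Plane) :
    lineAverage e (y, 0, w) = fderiv ℝ e y w := by
  simp [lineAverage]

/-- The second order analogue of `lineAverage`. -/
noncomputable def lineAverageTwo (e : Plane → ℝ) (z : Plane × ℝ × Plane) : ℝ :=
  ∫ t in (0 : ℝ)..1, (1 - t) * fderiv ℝ (fderiv ℝ e) (z.1 + t • z.2.1 • z.2.2) z.2.2 z.2.2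

theorem contDiff_lineAverageTwo {e : Plane → ℝ} {n : ℕ} (he : ContDiff ℝ (n + 2 : ℕ) e) :
    ContDiff ℝ n (lineAverageTwo e) := by
  refine contDiff_intervalIntegral_param n
    (F := fun z : (Plane × ℝ × Plane) × ℝ => (1 - z.2) *
      fderiv ℝ (fderiv ℝ e) (z.1.1 + z.2 • z.1.2.1 • z.1.2.2) z.1.2.2 z.1.2.2) ?_
  have h1 : ContDiff ℝ (n + 1 : ℕ) (fderiv ℝ e) := he.fderiv_right (by norm_cast)
  have h2 : ContDiff ℝ n (fderiv ℝ (fderiv ℝ e)) := h1.fderiv_right (by norm_cast)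
  exact (by fun_prop : ContDiff ℝ n fun z : (Plane × ℝ × Plane) × ℝ => 1 - z.2).mul
    (((h2.comp (by fun_prop)).clm_apply (by fun_prop)).clm_apply (by fun_prop))

theorem apply_add_eq_lineAverageTwo {e : Plane → ℝ} (he : ContDiff ℝ 2 e) (y : Plane) (ρ : ℝ)
    (w : Plane) :
    e (y + ρ • w) = e y + ρ * fderiv ℝ e y w + ρ ^ 2 * lineAverageTwo e (y, ρ, w) := by
  have := map_add_eq_sum_add_integral_iteratedFDeriv (f := e) (x := y) (y := ρ • w) (n := 1)
    (fun t _ => by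
      have := he.contDiffAt (x := y + t • ρ • w)
      norm_cast)
  have h2 : ∀ z, iteratedFDeriv ℝ (1 + 1) e z (fun _ => ρ • w) =
      ρ ^ 2 * fderiv ℝ (fderiv ℝ e) z w w := fun z => by
    refine (iteratedFDeriv_two_apply e z _).trans ?_
    simp only [map_smul, smul_apply, smul_eq_mul]
    ring
  rw [this, lineAverageTwo, ← intervalIntegral.integral_const_mul, Finset.sum_range_succ,
    Finset.sum_range_one]
  simp only [h2, iteratedFDeriv_zero_apply, iteratedFDeriv_one_apply, map_smul, smul_eq_mul,
    Nat.factorial, Nat.cast_one, inv_one, one_mul, pow_one, mul_one]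
  congr 1
  refine intervalIntegral.integral_congr fun t _ => ?_
  ring

theorem lineAverageTwo_zero (e : Plane → ℝ) (y w : Plane) :
    lineAverageTwo e (y, 0, w) = fderiv ℝ (fderiv ℝ e) y w w / 2 := by
  simp only [lineAverageTwo, zero_smul, smul_zero, add_zero, intervalIntegral.integral_mul_const]
  rw [intervalIntegral.integral_sub (by simp) (by simp), integral_id]
  norm_num
  ring

/-! ### Blowing up the zero set -/

/-- In the blown-up coordinates `(x, u) ↦ q + coordVec i x (x * u)` the function `E` is a monomial
of degree one or two times a `C^n` function whose zeros over `x = 0` are simple. -/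
def HasBlowup (E : Plane → ℝ) (n : ℕ) (q : Plane) (i : Fin 2) : Prop :=
  ∃ N : ℕ, N ≠ 0 ∧ N ≤ 2 ∧ ∃ G : ℝ × ℝ → ℝ, ContDiff ℝ n G ∧
    (∀ x u, E (q + coordVec i x (x * u)) = x ^ N * G (x, u)) ∧
    ∀ u, G (0, u) = 0 → fderiv ℝ G (0, u) (0, 1) ≠ 0

theorem fderiv_apply_snd {G : ℝ × ℝ → ℝ} {x u : ℝ} (hG : DifferentiableAt ℝ G (x, u)) :
    fderiv ℝ G (x, u) (0, 1) = deriv (fun u => G (x, u)) u := by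
  have hd : HasDerivAt (fun v : ℝ => (x, v)) ((0 : ℝ), (1 : ℝ)) u :=
    (hasDerivAt_const u x).prodMk (hasDerivAt_id u)
  exact (hG.hasFDerivAt.comp_hasDerivAt u hd).deriv.symm

theorem coordVec_self_mul (i : Fin 2) (x u : ℝ) :
    coordVec i x (x * u) = x • coordVec i 1 u := by
  rw [← coordVec_mul, mul_one]

/-- Here `G (0, u)` is the differential at `q` applied to `(1, u)`, affine in `u`. If its value and
its slope vanished together, the differential would be zero. -/
theorem hasBlowup_of_fderiv_ne_zero {e : Plane → ℝ} {n : ℕ} (hn : n ≠ 0)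
    (he : ContDiff ℝ (n + 1 : ℕ) e) {q : Plane} (hq : e q = 0) (hd : fderiv ℝ e q ≠ 0)
    (i : Fin 2) : HasBlowup e n q i := by
  have hG : ContDiff ℝ n fun z : ℝ × ℝ => lineAverage e (q, z.1, coordVec i 1 z.2) :=
    (contDiff_lineAverage he).comp
      (contDiff_const.prodMk (contDiff_fst.prodMk (contDiff_const.coordVec i contDiff_snd)))
  refine ⟨1, one_ne_zero, one_le_two, _, hG, fun x u => ?_, fun u hu => ?_⟩
  · rw [coordVec_self_mul, apply_add_eq_lineAverage (he.of_le (by norm_cast; omega)), hq, zero_add,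
      pow_one]
  · rw [fderiv_apply_snd (hG.differentiable (by simpa using hn) _)]
    simp only [lineAverage_zero] at hu ⊢
    have h1 : HasDerivAt (fun u => fderiv ℝ e q (coordVec i 1 u))
        (fderiv ℝ e q (coordVec i 0 1)) u :=
      (fderiv ℝ e q).hasFDerivAt.comp_hasDerivAt u ((hasDerivAt_const u 1).coordVec i (hasDerivAt_id u))
    rw [h1.deriv]
    intro h0
    apply hd
    ext w
    obtain ⟨x, y, rfl⟩ := exists_eq_coordVec i w
    rw [coordVec_eq, map_add, map_smul, map_smul, h0, smul_zero, add_zero, one_smul] at hu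
    rw [coordVec_eq, map_add, map_smul, map_smul, h0, hu]
    simp

/-- Here `G (0, u)` is half the Hessian form at `v = (1, u)`. At a double root `v` is orthogonal to
itself and to `(0, 1)`; these span the plane, so `v` would lie in the kernel of the Hessian. -/
theorem hasBlowup_of_fderiv_eq_zero {e : Plane → ℝ} {n : ℕ} (hn : n ≠ 0)
    (he : ContDiff ℝ (n + 2 : ℕ) e) {q : Plane} (hq : e q = 0) (hd : fderiv ℝ e q = 0)
    (hdd : ∀ v, fderiv ℝ (fderiv ℝ e) q v = 0 → v = 0) (i : Fin 2) : HasBlowup e n q i := by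
  have hG : ContDiff ℝ n fun z : ℝ × ℝ => lineAverageTwo e (q, z.1, coordVec i 1 z.2) :=
    (contDiff_lineAverageTwo he).comp
      (contDiff_const.prodMk (contDiff_fst.prodMk (contDiff_const.coordVec i contDiff_snd)))
  refine ⟨2, two_ne_zero, le_rfl, _, hG, fun x u => ?_, fun u hu => ?_⟩
  · rw [coordVec_self_mul, apply_add_eq_lineAverageTwo (he.of_le (by norm_cast; omega)), hq, hd]
    simp
  · rw [fderiv_apply_snd (hG.differentiable (by simpa using hn) _)]
    simp only [lineAverageTwo_zero] at hu ⊢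
    set B := fderiv ℝ (fderiv ℝ e) q with hB
    have hsymm : ∀ v w, B v w = B w v :=
      (he.contDiffAt (x := q)).isSymmSndFDerivAt (by simp)
    have hc : HasDerivAt (fun u => coordVec i 1 u) (coordVec i 0 1) u :=
      (hasDerivAt_const u 1).coordVec i (hasDerivAt_id u)
    have h1 : HasDerivAt (fun u => B (coordVec i 1 u) (coordVec i 1 u) / 2)
        ((B (coordVec i 0 1) (coordVec i 1 u) + B (coordVec i 1 u) (coordVec i 0 1)) / 2) u :=
      ((B.hasFDerivAt.comp_hasDerivAt u hc).clm_apply hc).div_const 2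
    rw [h1.deriv, hsymm (coordVec i 0 1)]
    intro h0
    have h2 : B (coordVec i 1 u) (coordVec i 0 1) = 0 := by linarith
    have h3 : B (coordVec i 1 u) (coordVec i 1 u) = 0 := by linarith
    refine coordVec_one_ne_zero i u (hdd _ ?_)
    ext w
    obtain ⟨x, y, rfl⟩ := exists_eq_coordVec i w
    have h4 : B (coordVec i 1 u) (coordVec i 1 0) = 0 := by
      have := h3
      conv at this => lhs; arg 2; rw [coordVec_eq]
      simpa [h2] using this
    rw [coordVec_eq i x, map_add, map_smul, map_smul, h2, h4]
    simp

theorem fderiv_fderiv_injective {e : Plane → ℝ} {q : Plane} (h : (hessianMatrix e q).det ≠ 0)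
    (v : Plane) (hv : fderiv ℝ (fderiv ℝ e) q v = 0) : v = 0 := by
  by_contra hne
  refine h (Matrix.exists_vecMul_eq_zero_iff.1 ⟨v.ofLp, ?_, ?_⟩)
  · intro h0; apply hne; ext j; simp [h0]
  · ext j
    have hsum : v = v 0 • EuclideanSpace.single 0 (1 : ℝ) + v 1 • EuclideanSpace.single 1 (1 : ℝ) := by
      ext j; fin_cases j <;> simp
    have := congrArg (fun L => L (EuclideanSpace.single j (1 : ℝ))) hv
    rw [hsum] at this
    simpa [Matrix.vecMul, dotProduct, hessianMatrix, iteratedFDeriv_two_apply] using this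

theorem gradient_eq_zero_iff {e : Plane → ℝ} {q : Plane} :
    gradient e q = 0 ↔ fderiv ℝ e q = 0 := by
  simp [gradient]

theorem hasBlowup_of_mem_fermiCurve {e : Plane → ℝ} {n : ℕ} (hn : n ≠ 0)
    (he : ContDiff ℝ (n + 2 : ℕ) e) (h4 : HypH4 e) {q : Plane} (hq : q ∈ fermiCurve e)
    (i : Fin 2) : HasBlowup e n q i := by
  by_cases hd : fderiv ℝ e q = 0
  · exact hasBlowup_of_fderiv_eq_zero hn he hq hd
      (fderiv_fderiv_injective (h4 q ⟨hq, gradient_eq_zero_iff.2 hd⟩).1) i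
  · exact hasBlowup_of_fderiv_ne_zero hn (he.of_le (by norm_cast; omega)) hq hd i

/-- Negation sends `x (1, u)` to `(-x) (1, u)`: the slope `u` is unchanged, and only `x` and the
sign `(-1) ^ N` are affected. -/
theorem HasBlowup.comp_neg {e : Plane → ℝ} {n : ℕ} (hn : n ≠ 0) {q : Plane} {i : Fin 2}
    (h : HasBlowup e n (-q) i) : HasBlowup (fun k => e (-k)) n q i := by
  obtain ⟨N, hN, hN2, G, hG, hfac, hroot⟩ := h
  have hG' : ContDiff ℝ n fun z : ℝ × ℝ => (-1) ^ N * G (-z.1, z.2) :=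
    contDiff_const.mul (hG.comp (contDiff_fst.neg.prodMk contDiff_snd))
  refine ⟨N, hN, hN2, _, hG', fun x u => ?_, fun u hu => ?_⟩
  · have := hfac (-x) u
    rw [coordVec_self_mul] at this ⊢
    beta_reduce
    rw [neg_add, ← neg_smul, this, neg_pow]
    ring
  · have hp : ((-1 : ℝ)) ^ N ≠ 0 := pow_ne_zero _ (by norm_num)
    simp only [neg_zero, mul_eq_zero, hp, false_or] at hu
    have := hroot u hu
    rw [fderiv_apply_snd (hG.differentiable (by simpa using hn) _)] at this
    rw [fderiv_apply_snd (hG'.differentiable (by simpa using hn) _)]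
    simp only [neg_zero]
    rw [deriv_const_mul_field]
    exact mul_ne_zero hp this

-- The final inequality, from strict differentiability, has two uses: it shows that every nearby
-- zero of `G` is on the branch, and it converts smallness of `G` into closeness to the branch.
open Filter in
theorem exists_branch {G : ℝ × ℝ → ℝ} {n : ℕ} (hn : n ≠ 0) (hG : ContDiff ℝ n G) {u0 : ℝ}
    (h0 : G (0, u0) = 0) (hd : fderiv ℝ G (0, u0) (0, 1) ≠ 0) :
    ∃ u : ℝ → ℝ, ContDiffAt ℝ n u 0 ∧ u 0 = u0 ∧ (∀ᶠ x in 𝓝 0, G (x, u x) = 0) ∧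
      ∃ C > 0, ∀ᶠ z in 𝓝 ((0 : ℝ), u0), |z.2 - u z.1| ≤ C * |G z| := by
  have hn' : (n : WithTop ℕ∞) ≠ 0 := by simpa using hn
  have cdf : ContDiffAt ℝ n G (0, u0) := hG.contDiffAt
  have hinv : (fderiv ℝ G (0, u0) ∘L .inr ℝ ℝ ℝ).IsInvertible := by
    refine ⟨ContinuousLinearEquiv.unitsEquivAut ℝ (Units.mk0 _ hd), ?_⟩
    ext
    simp
  set u := cdf.implicitFunction hn' hinv with hu
  have hu0 : u 0 = u0 := cdf.implicitFunction_apply_self hn' hinv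
  have hcd : ContDiffAt ℝ n u 0 := cdf.contDiffAt_implicitFunction hn' hinv
  have hz : ∀ᶠ x in 𝓝 0, G (x, u x) = 0 := by
    have := cdf.eventually_apply_implicitFunction hn' hinv
    rwa [h0] at this
  refine ⟨u, hcd, hu0, hz, ?_⟩
  set c := fderiv ℝ G (0, u0) (0, 1) with hc
  have hc0 : 0 < |c| := abs_pos.2 hd
  refine ⟨2 / |c|, by positivity, ?_⟩
  have hstrict := (cdf.hasStrictFDerivAt hn').isLittleO.def (half_pos hc0)
  have ht : Tendsto (fun z : ℝ × ℝ => (z, (z.1, u z.1))) (𝓝 (0, u0)) (𝓝 ((0, u0), (0, u0))) := by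
    have hc1 : ContinuousAt (fun z : ℝ × ℝ => u z.1) (0, u0) :=
      ContinuousAt.comp (f := Prod.fst) hcd.continuousAt continuousAt_fst
    have : ContinuousAt (fun z : ℝ × ℝ => (z, (z.1, u z.1))) (0, u0) :=
      continuousAt_id.prodMk (continuousAt_fst.prodMk hc1)
    simpa [ContinuousAt, hu0] using this
  filter_upwards [ht.eventually hstrict, continuousAt_fst.eventually hz] with z hz1 hz2
  have e1 : z - (z.1, u z.1) = (z.2 - u z.1) • ((0 : ℝ), (1 : ℝ)) := by
    ext <;> simp
  simp only [hz2, sub_zero, e1, map_smul, smul_eq_mul, ← hc] at hz1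
  rw [norm_smul, Prod.norm_def] at hz1
  simp only [norm_zero, norm_one, zero_le_one, sup_of_le_right, mul_one, Real.norm_eq_abs] at hz1
  have h3 : |(z.2 - u z.1) * c| ≤ |G z| + |G z - (z.2 - u z.1) * c| := by
    rw [abs_sub_comm (G z)]
    have := abs_add_le (G z) ((z.2 - u z.1) * c - G z)
    simpa using this
  rw [abs_mul] at h3
  rw [div_mul_eq_mul_div, le_div_iff₀ hc0]
  linarith

/-! ### Order of contact along a graph -/

open Filter Asymptotics in
theorem isLittleO_pow_sub_of_pow_mul {A : ℝ → ℝ} {N k : ℕ} (hN : N ≤ k)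
    (h : (fun x => x ^ N * A x) =o[𝓝[≠] 0] fun x => x ^ k) :
    A =o[𝓝[≠] 0] fun x : ℝ => x ^ (k - N) := by
  have h1 := (isBigO_refl (fun x : ℝ => (x ^ N)⁻¹) (𝓝[≠] 0)).mul_isLittleO h
  refine h1.congr' ?_ ?_
  · filter_upwards [self_mem_nhdsWithin] with x hx
    exact inv_mul_cancel_left₀ (pow_ne_zero _ hx) _
  · filter_upwards [self_mem_nhdsWithin] with x hx
    rw [pow_sub₀ _ hx hN, mul_comm]

open Filter Asymptotics in
theorem isBigO_pow_of_le {a b : ℕ} (h : a ≤ b) :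
    (fun x : ℝ => x ^ b) =O[𝓝[≠] 0] fun x => x ^ a :=
  (IsBigO.of_bound 1 (by
    filter_upwards [Metric.ball_mem_nhds (0 : ℝ) one_pos] with x hx
    rw [one_mul, norm_pow, norm_pow]
    exact pow_le_pow_of_le_one (norm_nonneg _) (mem_ball_zero_iff.1 hx).le h)).mono
    nhdsWithin_le_nhds

open Filter Asymptotics in
theorem tendsto_zero_of_isLittleO_pow {A : ℝ → ℝ} {k : ℕ}
    (h : A =o[𝓝[≠] 0] fun x : ℝ => x ^ k) : Tendsto A (𝓝[≠] 0) (𝓝 0) := by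
  have := h.trans_isBigO (isBigO_pow_of_le k.zero_le)
  simpa using this

open Asymptotics in
theorem isLittleO_nhds_of_punctured {A B : ℝ → ℝ} (h : A =o[𝓝[≠] 0] B) (h0 : A 0 = 0) :
    A =o[𝓝 0] B := by
  rwa [← isLittleO_insert h0, Set.insert_eq, Set.union_compl_self, nhdsWithin_univ] at h

open Filter in
theorem tendsto_slope_pair {f : ℝ → ℝ} (hf : DifferentiableAt ℝ f 0) (h0 : f 0 = 0) :
    Tendsto (fun x => (x, f x / x)) (𝓝[≠] 0) (𝓝 (0, deriv f 0)) := by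
  have h1 := hasDerivAt_iff_tendsto_slope_zero.1 hf.hasDerivAt
  have h2 : Tendsto (fun x => f x / x) (𝓝[≠] 0) (𝓝 (deriv f 0)) := by
    refine h1.congr fun t => ?_
    simp [h0, div_eq_inv_mul]
  exact (tendsto_id.mono_left nhdsWithin_le_nhds).prodMk_nhds h2

open Filter in
theorem eq_zero_of_tendsto_slope {f : ℝ → ℝ} (hf : DifferentiableAt ℝ f 0) (h0 : f 0 = 0)
    {G : ℝ × ℝ → ℝ} (hG : Continuous G) (h : Tendsto (fun x => G (x, f x / x)) (𝓝[≠] 0) (𝓝 0)) :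
    G (0, deriv f 0) = 0 :=
  tendsto_nhds_unique ((hG.tendsto _).comp (tendsto_slope_pair hf h0)) h

open Filter Asymptotics in
/-- If a graph has contact of order at most `k - 1` with every branch of `{E = 0}` at `q`, then `E`
restricted to the graph vanishes to order at most `k`. -/
theorem exists_iteratedDeriv_ne_zero_of_hasBlowup {E : Plane → ℝ} {n k : ℕ} {q : Plane} {i : Fin 2}
    (hE : ContDiff ℝ n E) (hB : HasBlowup E n q i) {f : ℝ → ℝ} (hf : ContDiffAt ℝ n f 0)
    (hf0 : f 0 = 0) (hk : 2 ≤ k) (hkn : k ≤ n)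
    (hnest : ∀ g, ContDiffAt ℝ n g 0 → g 0 = 0 → (∀ᶠ x in 𝓝 0, E (q + coordVec i x (g x)) = 0) →
      ∃ m, m + 1 ≤ k ∧ iteratedDeriv m (fun x => f x - g x) 0 ≠ 0) :
    ∃ m ≤ k, iteratedDeriv m (fun x => E (q + coordVec i x (f x))) 0 ≠ 0 := by
  by_contra! hcon
  have hn : n ≠ 0 := by omega
  have hfd : DifferentiableAt ℝ f 0 := hf.differentiableAt (by simpa using hn)
  obtain ⟨N, hN0, hN2, G, hG, hfac, hroot⟩ := hB
  have hcd : ContDiffAt ℝ n (fun x => E (q + coordVec i x (f x))) 0 :=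
    hE.contDiffAt.comp 0 (contDiffAt_const.add (contDiffAt_id.coordVec i hf))
  have h1 := (isLittleO_pow_of_iteratedDeriv_eq_zero
    (hcd.of_le (by exact_mod_cast hkn : (k : WithTop ℕ∞) ≤ n)) hcon).mono
    (nhdsWithin_le_nhds (s := {0}ᶜ))
  have h2 : (fun x => G (x, f x / x)) =o[𝓝[≠] 0] fun x : ℝ => x ^ (k - N) := by
    refine isLittleO_pow_sub_of_pow_mul (hN2.trans hk) (h1.congr' ?_ EventuallyEq.rfl)
    filter_upwards [self_mem_nhdsWithin] with x hx
    rw [← hfac, mul_div_cancel₀ _ (show x ≠ 0 from hx)]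
  -- The slope of the graph at `0` is a root of `G (0, ·)`, so a branch `x * u x` of the zero set
  -- leaves `q` in the same direction.
  have h3 := eq_zero_of_tendsto_slope hfd hf0 hG.continuous (tendsto_zero_of_isLittleO_pow h2)
  obtain ⟨u, hu, hu0, huG, C, hC, hlow⟩ := exists_branch hn hG h3 (hroot _ h3)
  obtain ⟨m, hm, hne⟩ := hnest (fun x => x * u x) (contDiffAt_id.mul hu) (by simp) (by
    filter_upwards [huG] with x hx
    rw [hfac, hx, mul_zero])
  have h4 : (fun x => f x / x - u x) =o[𝓝[≠] 0] fun x : ℝ => x ^ (k - N) := by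
    refine (IsBigO.of_bound C ?_).trans_isLittleO h2
    filter_upwards [(tendsto_slope_pair hfd hf0).eventually hlow] with x hx
    simpa using hx
  -- Division by `x ^ N` cost `N` orders and multiplication by `x` regains one. Since `N ≤ 2`, at
  -- most one order is lost.
  have h5 : (fun x => f x - x * u x) =o[𝓝[≠] 0] fun x : ℝ => x ^ (k - 1) := by
    have := (isBigO_refl (fun x : ℝ => x) (𝓝[≠] 0)).mul_isLittleO h4
    refine IsLittleO.trans_isBigO (this.congr' ?_ ?_)
      (isBigO_pow_of_le (show k - 1 ≤ k - N + 1 by omega))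
    · filter_upwards [self_mem_nhdsWithin] with x hx
      rw [mul_sub, mul_div_cancel₀ _ (show x ≠ 0 from hx)]
    · exact Eventually.of_forall fun x => (pow_succ' x _).symm
  have hle : ((k - 1 : ℕ) : WithTop ℕ∞) ≤ n := by norm_cast; omega
  exact hne (iteratedDeriv_eq_zero_of_isLittleO_pow
    ((hf.sub (contDiffAt_id.mul hu)).of_le hle) (isLittleO_nhds_of_punctured h5 (by simp [hf0]))
    m (by omega))

open Filter Asymptotics in
/-- If a graph in `{e = 0}` is not flat of order `k - 1`, then every directional derivative of `e`
vanishes along the graph to order at most `k`. -/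
theorem exists_iteratedDeriv_fderiv_ne_zero_of_hasBlowup {e : Plane → ℝ} {n k : ℕ} {q : Plane}
    {i : Fin 2} (he : ContDiff ℝ (n + 1 : ℕ) e) (hB : HasBlowup e n q i) {f : ℝ → ℝ}
    (hf : ContDiffAt ℝ n f 0) (hf0 : f 0 = 0)
    (hin : ∀ᶠ x in 𝓝 0, e (q + coordVec i x (f x)) = 0) (hkn : k ≤ n)
    (hflat : ∃ m, 2 ≤ m ∧ m + 1 ≤ k ∧ iteratedDeriv m f 0 ≠ 0) {w : Plane} (hw : w ≠ 0) :
    ∃ m ≤ k, iteratedDeriv m (fun x => fderiv ℝ e (q + coordVec i x (f x)) w) 0 ≠ 0 := by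
  by_contra! hcon
  obtain ⟨m, hm2, hmk, hne⟩ := hflat
  have hn : n ≠ 0 := by omega
  have hfd : DifferentiableAt ℝ f 0 := hf.differentiableAt (by simpa using hn)
  obtain ⟨N, hN0, hN2, G, hG, hfac, hroot⟩ := hB
  obtain ⟨a, b, rfl⟩ := exists_eq_coordVec i w
  have hed : Differentiable ℝ e := he.differentiable (by simp)
  have hcd : ContDiffAt ℝ n (fun x => fderiv ℝ e (q + coordVec i x (f x)) (coordVec i a b)) 0 :=
    ((he.fderiv_right (m := n) (by norm_cast)).contDiffAt.comp (0 : ℝ)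
      (contDiffAt_const.add (contDiffAt_id.coordVec i hf))).clm_apply contDiffAt_const
  have h1 := (isLittleO_pow_of_iteratedDeriv_eq_zero
    (hcd.of_le (by exact_mod_cast hkn : (k : WithTop ℕ∞) ≤ n)) hcon).mono
    (nhdsWithin_le_nhds (s := {0}ᶜ))
  have hG0 : G (0, deriv f 0) = 0 := by
    refine eq_zero_of_tendsto_slope hfd hf0 hG.continuous (tendsto_const_nhds.congr' ?_)
    filter_upwards [self_mem_nhdsWithin, nhdsWithin_le_nhds hin] with x hx hex
    have := hfac x (f x / x)
    rw [mul_div_cancel₀ _ (show x ≠ 0 from hx), hex] at this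
    exact ((mul_eq_zero.1 this.symm).resolve_left (pow_ne_zero _ hx)).symm
  set c := |fderiv ℝ G (0, deriv f 0) (0, 1)| with hc
  have hc0 : 0 < c := abs_pos.2 (hroot _ hG0)
  have hGlow : ∀ᶠ x in 𝓝[≠] (0 : ℝ), c / 2 ≤ |fderiv ℝ G (x, f x / x) (0, 1)| := by
    have hcont : Continuous fun z => |fderiv ℝ G z (0, 1)| :=
      ((hG.continuous_fderiv (by simpa using hn)).clm_apply continuous_const).abs
    have := ((hcont.tendsto _).comp (tendsto_slope_pair hfd hf0)).eventually
      (lt_mem_nhds (half_lt_self hc0))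
    exact this.mono fun x hx => hx.le
  have hfdev : ∀ᶠ x in 𝓝 (0 : ℝ), DifferentiableAt ℝ f x := by
    filter_upwards [hf.eventually (by simp)] with x hx
    exact hx.differentiableAt (by simpa using hn)
  -- Let `e₁`, `e₂` be the partial derivatives on the graph. Tangency `e₁ + f' e₂ = 0` makes the
  -- derivative along `w = (a, b)` equal to `(b - a f') e₂`. The blow-up gives `x e₂ = x ^ N ∂ᵤG`,
  -- with `∂ᵤG` bounded away from zero.
  have h2 : (fun x => x ^ N * (b - a * deriv f x)) =o[𝓝[≠] 0] fun x : ℝ => x ^ (k + 1) := by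
    have h2' := (isBigO_refl (fun x : ℝ => x) (𝓝[≠] 0)).mul_isLittleO h1
    refine (IsBigO.of_bound (2 / c) ?_).trans_isLittleO
      (h2'.congr_right fun x => (pow_succ' x k).symm)
    filter_upwards [self_mem_nhdsWithin, nhdsWithin_le_nhds hin.eventually_nhds, hGlow,
      nhdsWithin_le_nhds hfdev] with x hx hex hlow hfx
    have hx0 : x ≠ 0 := hx
    have htan : fderiv ℝ e (q + coordVec i x (f x)) (coordVec i 1 (deriv f x)) = 0 := by
      have hd := (hed (q + coordVec i x (f x))).hasFDerivAt.comp_hasDerivAt x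
        (((hasDerivAt_id x).coordVec i hfx.hasDerivAt).const_add q)
      exact hd.unique ((hasDerivAt_const x (0 : ℝ)).congr_of_eventuallyEq hex)
    have hnor : x * fderiv ℝ e (q + coordVec i x (f x)) (coordVec i 0 1) =
        x ^ N * fderiv ℝ G (x, f x / x) (0, 1) := by
      have hxu : x * (f x / x) = f x := mul_div_cancel₀ _ hx0
      have hd := (hed (q + coordVec i x (x * (f x / x)))).hasFDerivAt.comp_hasDerivAt (f x / x)
        (((hasDerivAt_const (f x / x) x).coordVec i
          ((hasDerivAt_id (f x / x)).const_mul x)).const_add q)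
      have hd2 : HasDerivAt (fun u => x ^ N * G (x, u))
          (x ^ N * fderiv ℝ G (x, f x / x) (0, 1)) (f x / x) := by
        refine HasDerivAt.const_mul _ ?_
        exact ((hG.differentiable (by simpa using hn)) _).hasFDerivAt.comp_hasDerivAt (f x / x)
          ((hasDerivAt_const (f x / x) x).prodMk (hasDerivAt_id (f x / x)))
      have := hd.unique (hd2.congr_of_eventuallyEq (Eventually.of_forall fun u => hfac x u))
      rw [hxu, coordVec_eq i 0, zero_smul, zero_add, map_smul, mul_one, smul_eq_mul] at this
      exact this
    rw [coordVec_eq i 1, map_add, map_smul, map_smul, one_smul, smul_eq_mul] at htan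
    have hval : x ^ N * (b - a * deriv f x) * fderiv ℝ G (x, f x / x) (0, 1) =
        x * fderiv ℝ e (q + coordVec i x (f x)) (coordVec i a b) := by
      rw [coordVec_eq i a b, map_add, map_smul, map_smul, smul_eq_mul, smul_eq_mul]
      linear_combination (-(b - a * deriv f x)) * hnor - a * x * htan
    rw [← hval, norm_mul _ (fderiv ℝ G (x, f x / x) (0, 1)), Real.norm_eq_abs (fderiv ℝ G _ _)]
    calc ‖x ^ N * (b - a * deriv f x)‖ = 2 / c * (‖x ^ N * (b - a * deriv f x)‖ * (c / 2)) := by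
          field_simp
      _ ≤ _ := by gcongr
  have h3 : (fun x => b - a * deriv f x) =o[𝓝[≠] 0] fun x : ℝ => x ^ (k - 1) :=
    (isLittleO_pow_sub_of_pow_mul (by omega) h2).trans_isBigO (isBigO_pow_of_le (by omega))
  have hdf : ContDiffAt ℝ (n - 1 : ℕ) (deriv f) 0 :=
    ContDiffAt.deriv_of_succ (by rwa [Nat.sub_add_cancel (by omega)])
  have hth : ContDiffAt ℝ (n - 1 : ℕ) (fun x => b - a * deriv f x) 0 :=
    contDiffAt_const.sub (contDiffAt_const.mul hdf)
  have h4 : b - a * deriv f 0 = 0 :=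
    tendsto_nhds_unique (hth.continuousAt.tendsto.mono_left nhdsWithin_le_nhds)
      (tendsto_zero_of_isLittleO_pow h3)
  have hle : ((k - 1 : ℕ) : WithTop ℕ∞) ≤ (n - 1 : ℕ) := by norm_cast; omega
  have h5 := iteratedDeriv_eq_zero_of_isLittleO_pow (hth.of_le hle)
    (isLittleO_nhds_of_punctured h3 h4)
  have ha : a ≠ 0 := by
    rintro rfl
    apply hw
    rw [show b = 0 by simpa using h4, coordVec_zero]
  -- Since `m ≥ 2`, differentiating `b - a f'` another `m - 1 ≥ 1` times removes `b` and leaves `-a`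
  -- times the `m`-th derivative of `f`.
  obtain ⟨m', rfl⟩ : ∃ m', m = m' + 2 := ⟨m - 2, by omega⟩
  have h6 := h5 (m' + 1) (by omega)
  rw [iteratedDeriv_succ', show deriv (fun x => b - a * deriv f x) =
    fun x => (-a) * deriv (deriv f) x by ext x; simp] at h6
  rw [iteratedDeriv_const_mul_field, ← iteratedDeriv_succ', ← iteratedDeriv_succ'] at h6
  exact (mul_ne_zero (neg_ne_zero.2 ha) hne) h6

/-! ### Covering the Fermi curve by graphs -/

-- Near a slope `u0`, either `G (0, u0) ≠ 0` and there are no zeros, or all zeros of `G` lie on one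
-- branch. Compactness of `[-1, 1]` leaves finitely many branches.
open Filter in
theorem exists_finite_graphs_of_slope_le_one {e : Plane → ℝ} {n : ℕ} (hn : n ≠ 0) {q : Plane}
    {i : Fin 2} (hB : HasBlowup e n q i) :
    ∃ T : Set (ℝ → ℝ), T.Finite ∧ (∀ g ∈ T, IsGraphIn (fermiCurve e) n q i g) ∧
      ∀ᶠ x in 𝓝 (0 : ℝ), ∀ u ∈ Set.Icc (-1 : ℝ) 1, x ≠ 0 → e (q + coordVec i x (x * u)) = 0 →
        ∃ g ∈ T, x * u = g x := by
  obtain ⟨N, hN0, hN2, G, hG, hfac, hroot⟩ := hB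
  refine isCompact_Icc.induction_on (p := fun S => ∃ T : Set (ℝ → ℝ), T.Finite ∧
    (∀ g ∈ T, IsGraphIn (fermiCurve e) n q i g) ∧
      ∀ᶠ x in 𝓝 (0 : ℝ), ∀ u ∈ S, x ≠ 0 → e (q + coordVec i x (x * u)) = 0 →
        ∃ g ∈ T, x * u = g x) ?_ ?_ ?_ ?_
  · exact ⟨∅, Set.finite_empty, by simp, by simp⟩
  · rintro s t hst ⟨T, hT, hg, hev⟩
    exact ⟨T, hT, hg, hev.mono fun x hx u hu => hx u (hst hu)⟩
  · rintro s t ⟨T, hT, hg, hev⟩ ⟨T', hT', hg', hev'⟩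
    refine ⟨T ∪ T', hT.union hT', fun g hgm => hgm.elim (hg g) (hg' g), ?_⟩
    filter_upwards [hev, hev'] with x hx hx' u hu h0 hz
    rcases hu with hu | hu
    · obtain ⟨g, hg, h⟩ := hx u hu h0 hz
      exact ⟨g, Or.inl hg, h⟩
    · obtain ⟨g, hg, h⟩ := hx' u hu h0 hz
      exact ⟨g, Or.inr hg, h⟩
  · intro u0 _
    suffices h : ∃ T : Set (ℝ → ℝ), T.Finite ∧ (∀ g ∈ T, IsGraphIn (fermiCurve e) n q i g) ∧
        ∀ᶠ z in 𝓝 ((0 : ℝ), u0), G z = 0 → ∃ g ∈ T, z.1 * z.2 = g z.1 by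
      obtain ⟨T, hT, hg, hev⟩ := h
      rw [nhds_prod_eq] at hev
      obtain ⟨pa, ha, pb, hb, hab⟩ := eventually_prod_iff.1 hev
      refine ⟨{u | pb u}, nhdsWithin_le_nhds hb, T, hT, hg, ?_⟩
      filter_upwards [ha] with x hx u hu h0 hz
      rw [hfac] at hz
      exact hab hx hu ((mul_eq_zero.1 hz).resolve_left (pow_ne_zero _ h0))
    by_cases h0 : G (0, u0) = 0
    · obtain ⟨u, hu, hu0, huG, C, hC, hlow⟩ := exists_branch hn hG h0 (hroot _ h0)
      refine ⟨{fun x => x * u x}, Set.finite_singleton _, ?_, ?_⟩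
      · rintro g rfl
        refine ⟨contDiffAt_id.mul hu, by simp, ?_⟩
        filter_upwards [huG] with x hx
        rw [fermiCurve, Set.mem_ofPred_eq, hfac, hx, mul_zero]
      · filter_upwards [hlow] with z hz hGz
        rw [hGz, abs_zero, mul_zero] at hz
        refine ⟨_, rfl, ?_⟩
        rw [sub_eq_zero.1 (abs_nonpos_iff.1 hz)]
    · refine ⟨∅, Set.finite_empty, by simp, ?_⟩
      filter_upwards [hG.continuous.continuousAt.eventually_ne h0] with z hz hz'
      exact absurd hz' hz

open Filter in
/-- Near a point where it can be blown up, the Fermi curve is covered by finitely many graphs. -/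
theorem exists_finite_graphs {e : Plane → ℝ} {n : ℕ} (hn : n ≠ 0) {q : Plane}
    (hB : ∀ i, HasBlowup e n q i) :
    ∃ T : Set (Fin 2 × (ℝ → ℝ)), T.Finite ∧
      (∀ t ∈ T, IsGraphIn (fermiCurve e) n q t.1 t.2) ∧
      ∀ η : Fin 2 × (ℝ → ℝ) → ℝ, (∀ t ∈ T, 0 < η t) → ∀ᶠ k in 𝓝 q, k ∈ fermiCurve e →
        k = q ∨ ∃ t ∈ T, ∃ x ∈ Set.Ioo (-η t) (η t), k = q + coordVec t.1 x (t.2 x) := by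
  choose T hT hg hev using fun i => exists_finite_graphs_of_slope_le_one hn (hB i)
  refine ⟨⋃ i, (Prod.mk i) '' T i, Set.finite_iUnion fun i => (hT i).image _, ?_, ?_⟩
  · intro t ht
    obtain ⟨i, g, hgT, rfl⟩ := Set.mem_iUnion.1 ht
    exact hg i g hgT
  -- The graphs are fixed before the widths `η`, so that each width can later be taken from the
  -- estimate valid on its graph.
  · intro η hη
    have hsmall : ∀ i, ∀ᶠ x in 𝓝 (0 : ℝ), ∀ g ∈ T i, x ∈ Set.Ioo (-η (i, g)) (η (i, g)) := by
      intro i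
      refine (eventually_all_finite (hT i)).2 fun g hgT => ?_
      have := hη (i, g) (Set.mem_iUnion.2 ⟨i, g, hgT, rfl⟩)
      exact Ioo_mem_nhds (by linarith) this
    have hmain : ∀ i, ∀ᶠ x₀ in 𝓝 (0 : ℝ), ∀ y, |y| ≤ |x₀| → x₀ ≠ 0 →
        e (q + coordVec i x₀ y) = 0 →
        ∃ t ∈ ⋃ i, (Prod.mk i) '' T i, ∃ x ∈ Set.Ioo (-η t) (η t),
          q + coordVec i x₀ y = q + coordVec t.1 x (t.2 x) := by
      intro i
      filter_upwards [hev i, hsmall i] with x hx hxs y hyx h0 hz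
      have hxu : x * (y / x) = y := mul_div_cancel₀ _ h0
      have hu : y / x ∈ Set.Icc (-1 : ℝ) 1 := by
        rw [Set.mem_Icc, ← abs_le, abs_div]
        exact div_le_one_of_le₀ hyx (abs_nonneg _)
      obtain ⟨g, hgT, hgx⟩ := hx (y / x) hu h0 (by rwa [hxu])
      rw [hxu] at hgx
      exact ⟨(i, g), Set.mem_iUnion.2 ⟨i, g, hgT, rfl⟩, x, hxs g hgT, by rw [hgx]⟩
    have hlim : ∀ i : Fin 2, Tendsto (fun k : Plane => (k - q) i) (𝓝 q) (𝓝 0) := fun i => by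
      have : Continuous fun k : Plane => (k - q) i := by fun_prop
      simpa using this.tendsto q
    filter_upwards [(hlim 0).eventually (hmain 0), (hlim 1).eventually (hmain 1)] with k h0 h1 hk
    by_cases hkq : k = q
    · exact Or.inl hkq
    right
    have e0 : q + coordVec 0 ((k - q) 0) ((k - q) 1) = k := by
      ext j; fin_cases j <;> simp [coordVec]
    have e1 : q + coordVec 1 ((k - q) 1) ((k - q) 0) = k := by
      ext j; fin_cases j <;> simp [coordVec]
    have hz : ∀ i : Fin 2, (k - q) i = 0 → (∀ j, |(k - q) j| ≤ |(k - q) i|) → False := by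
      intro i hi hj
      apply hkq
      rw [← sub_eq_zero]
      ext j
      have := hj j
      rw [hi, abs_zero] at this
      exact abs_nonpos_iff.1 this
    -- The cones of slope at most one over the two axes cover the plane.
    rcases le_total |(k - q) 1| |(k - q) 0| with h | h
    · have := h0 _ h (fun hi => hz 0 hi (by intro j; fin_cases j; exacts [le_rfl, h]))
        (by rw [e0]; exact hk)
      rwa [e0] at this
    · have := h1 _ h (fun hi => hz 1 hi (by intro j; fin_cases j; exacts [h, le_rfl]))
        (by rw [e1]; exact hk)
      rwa [e1] at this

/-! ### Sublevel sets along a single graph -/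

/-- Along the curve `γ` near parameter `0`, for translations `p` near `p₀`, the sublevel sets of
`E (p + γ x)` have measure at most a constant times `(ε / ‖p‖) ^ (1 / n)`. -/
def SublevelBound (E : Plane → ℝ) (n : ℕ) (p₀ : Plane) (γ : ℝ → Plane) : Prop :=
  ∃ η > 0, ∃ C > 0, ∀ᶠ p in 𝓝 p₀, p ≠ 0 → ∀ ε > 0,
    MeasureTheory.volume {x : ℝ | x ∈ Set.Ioo (-η) η ∧ |E (p + γ x)| ≤ ε} ≤
      ENNReal.ofReal (C * (ε / ‖p‖) ^ (1 / n : ℝ))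

-- For `p` near `p₀` one has `‖p‖ ≤ ‖p₀‖ + 1`, so replacing `ε` by `ε / ‖p‖` costs only a constant.
open Filter in
theorem sublevelBound_of_iteratedDeriv_ne_zero {E : Plane → ℝ} {n : ℕ} (hn : n ≠ 0)
    (hE : ContDiff ℝ n E) {γ : ℝ → Plane} (hγ : ContDiffAt ℝ n γ 0) {p₀ : Plane}
    (h : ∃ m ≤ n, iteratedDeriv m (fun x => E (p₀ + γ x)) 0 ≠ 0) : SublevelBound E n p₀ γ := by
  obtain ⟨m, hm, hne⟩ := h
  have hcd : ContDiffAt ℝ n (fun z : Plane × ℝ => E (z.1 + γ z.2)) (p₀, 0) := by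
    have h1 : ContDiffAt ℝ n (fun z : Plane × ℝ => γ z.2) (p₀, 0) :=
      ContDiffAt.comp (g := γ) (p₀, (0 : ℝ)) hγ contDiffAt_snd
    exact ContDiffAt.comp (g := E) (p₀, (0 : ℝ)) hE.contDiffAt (contDiffAt_fst.add h1)
  obtain ⟨η, hη, C, hC, hev⟩ := exists_uniform_volume_sublevel_le hm hn hcd hne
  have hR : 0 < ‖p₀‖ + 1 := by positivity
  refine ⟨η, hη, C * (‖p₀‖ + 1) ^ (1 / n : ℝ), by positivity, ?_⟩
  filter_upwards [hev, (continuous_norm.tendsto p₀).eventually (gt_mem_nhds (lt_add_one _))]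
    with p hp hlt hp0 ε hε
  refine (hp ε hε).trans (ENNReal.ofReal_le_ofReal ?_)
  have hpos : 0 < ‖p‖ := norm_pos_iff.2 hp0
  rw [mul_assoc, ← Real.mul_rpow hR.le (by positivity)]
  gcongr
  rw [← mul_div_assoc, le_div_iff₀ hpos, mul_comm]
  gcongr

-- Since `e (γ x) = 0`, the value `e (p + γ x)` is `‖p‖` times the average of the derivative in the
-- direction `w = p / ‖p‖`; the sublevel estimate is applied to this average at height `ε / ‖p‖`. At
-- `ρ = 0` the average is the derivative itself, and compactness of the unit circle makes the
-- estimate uniform in `w`.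
open Filter in
theorem sublevelBound_zero {e : Plane → ℝ} {n : ℕ} (hn : n ≠ 0) (he : ContDiff ℝ (n + 1 : ℕ) e)
    {γ : ℝ → Plane} (hγ : ContDiffAt ℝ n γ 0) (hγe : ∀ᶠ x in 𝓝 0, e (γ x) = 0)
    (h : ∀ w, w ≠ 0 → ∃ m ≤ n, iteratedDeriv m (fun x => fderiv ℝ e (γ x) w) 0 ≠ 0) :
    SublevelBound e n 0 γ := by
  have key : ∃ η > 0, ∃ C > 0, ∀ᶠ ρ in 𝓝 (0 : ℝ), ∀ w ∈ Metric.sphere (0 : Plane) 1, ∀ ε > 0,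
      MeasureTheory.volume {x : ℝ | x ∈ Set.Ioo (-η) η ∧ |lineAverage e (γ x, ρ, w)| ≤ ε} ≤
        ENNReal.ofReal (C * ε ^ (1 / n : ℝ)) := by
    refine (isCompact_sphere (0 : Plane) 1).induction_on
      (p := fun S => ∃ η > 0, ∃ C > 0, ∀ᶠ ρ in 𝓝 (0 : ℝ), ∀ w ∈ S, ∀ ε > 0,
        MeasureTheory.volume {x : ℝ | x ∈ Set.Ioo (-η) η ∧ |lineAverage e (γ x, ρ, w)| ≤ ε} ≤
          ENNReal.ofReal (C * ε ^ (1 / n : ℝ))) ?_ ?_ ?_ ?_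
    · exact ⟨1, one_pos, 1, one_pos, by simp⟩
    · rintro s t hst ⟨η, hη, C, hC, hev⟩
      exact ⟨η, hη, C, hC, hev.mono fun ρ hρ w hw => hρ w (hst hw)⟩
    · rintro s t ⟨η, hη, C, hC, hev⟩ ⟨η', hη', C', hC', hev'⟩
      refine ⟨min η η', lt_min hη hη', max C C', lt_max_of_lt_left hC, ?_⟩
      filter_upwards [hev, hev'] with ρ h1 h2 w hw ε hε
      have hεn : 0 ≤ ε ^ (1 / n : ℝ) := by positivity
      rcases hw with hw | hw
      · refine (MeasureTheory.measure_mono ?_).trans ((h1 w hw ε hε).trans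
          (ENNReal.ofReal_le_ofReal (mul_le_mul_of_nonneg_right (le_max_left _ _) hεn)))
        exact fun x hx => ⟨⟨(neg_le_neg (min_le_left _ _)).trans_lt hx.1.1,
          hx.1.2.trans_le (min_le_left _ _)⟩, hx.2⟩
      · refine (MeasureTheory.measure_mono ?_).trans ((h2 w hw ε hε).trans
          (ENNReal.ofReal_le_ofReal (mul_le_mul_of_nonneg_right (le_max_right _ _) hεn)))
        exact fun x hx => ⟨⟨(neg_le_neg (min_le_right _ _)).trans_lt hx.1.1,
          hx.1.2.trans_le (min_le_right _ _)⟩, hx.2⟩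
    · intro w₀ hw₀
      obtain ⟨m, hm, hne⟩ := h w₀ (ne_zero_of_mem_unit_sphere ⟨w₀, hw₀⟩)
      have hcd : ContDiffAt ℝ n (fun z : (ℝ × Plane) × ℝ => lineAverage e (γ z.2, z.1.1, z.1.2))
          ((0, w₀), 0) := by
        have h1 : ContDiffAt ℝ n (fun z : (ℝ × Plane) × ℝ => γ z.2) ((0, w₀), 0) :=
          ContDiffAt.comp (g := γ) ((0, w₀), (0 : ℝ)) hγ contDiffAt_snd
        exact ContDiffAt.comp (g := lineAverage e) ((0, w₀), (0 : ℝ))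
          (contDiff_lineAverage he).contDiffAt (h1.prodMk
            ((contDiffAt_fst.comp _ contDiffAt_fst).prodMk (contDiffAt_snd.comp _ contDiffAt_fst)))
      obtain ⟨η, hη, C, hC, hev⟩ := exists_uniform_volume_sublevel_le hm hn hcd
        (by simpa only [lineAverage_zero] using hne)
      rw [nhds_prod_eq] at hev
      obtain ⟨pa, ha, pb, hb, hab⟩ := eventually_prod_iff.1 hev
      exact ⟨{w | pb w}, nhdsWithin_le_nhds hb, η, hη, C, hC,
        ha.mono fun ρ hρ w hw ε hε => hab hρ hw ε hε⟩
  obtain ⟨η, hη, C, hC, hev⟩ := key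
  obtain ⟨η', hη', hball⟩ := Metric.eventually_nhds_iff_ball.1 hγe
  refine ⟨min η η', lt_min hη hη', C, hC, ?_⟩
  have hnorm : Tendsto (fun p : Plane => ‖p‖) (𝓝 0) (𝓝 0) := by
    simpa using (continuous_norm.tendsto (0 : Plane))
  filter_upwards [hnorm.eventually hev] with p hp hp0 ε hε
  have hpos : 0 < ‖p‖ := norm_pos_iff.2 hp0
  refine (MeasureTheory.measure_mono ?_).trans (hp (‖p‖⁻¹ • p) (by
    rw [mem_sphere_zero_iff_norm, norm_smul, norm_inv, norm_norm, inv_mul_cancel₀ hpos.ne'])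
    (ε / ‖p‖) (by positivity))
  rintro x ⟨hx, hle⟩
  refine ⟨⟨(neg_le_neg (min_le_left _ _)).trans_lt hx.1, hx.2.trans_le (min_le_left _ _)⟩, ?_⟩
  have hex : e (γ x) = 0 := hball x (by
    rw [mem_ball_zero_iff, Real.norm_eq_abs, abs_lt]
    exact ⟨(neg_le_neg (min_le_right _ _)).trans_lt hx.1, hx.2.trans_le (min_le_right _ _)⟩)
  have hfac := apply_add_eq_lineAverage (he.of_le (by norm_cast; omega)) (γ x) ‖p‖ (‖p‖⁻¹ • p)
  rw [smul_inv_smul₀ hpos.ne', hex, zero_add, add_comm] at hfac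
  rw [hfac, abs_mul, abs_norm] at hle
  rw [le_div_iff₀ hpos, mul_comm]
  exact hle

/-! ### From graphs to arc length -/

open Filter MeasureTheory Measure in
theorem exists_local_length_bound {e E : Plane → ℝ} {n N : ℕ} (hn : n ≠ 0) {p₀ q : Plane}
    (hB : ∀ i, HasBlowup e n q i)
    (hS : ∀ i f, IsGraphIn (fermiCurve e) n q i f →
      SublevelBound E N p₀ fun x => q + coordVec i x (f x)) :
    ∃ U ∈ 𝓝 q, ∃ C > 0, ∀ᶠ p in 𝓝 p₀, p ≠ 0 → ∀ ε > 0,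
      μH[1] {k : Plane | (k ∈ fermiCurve e ∧ |E (p + k)| ≤ ε) ∧ k ∈ U} ≤
        ENNReal.ofReal (C * (ε / ‖p‖) ^ (1 / N : ℝ)) := by
  obtain ⟨T, hT, hgraph, hcov⟩ := exists_finite_graphs hn hB
  have hloc : ∀ t : Fin 2 × (ℝ → ℝ), t ∈ T → ∃ η > 0, ∃ C > 0, ∀ᶠ p in 𝓝 p₀, p ≠ 0 → ∀ ε > 0,
      μH[1] ((fun x => q + coordVec t.1 x (t.2 x)) ''
        {x | x ∈ Set.Ioo (-η) η ∧ |E (p + (q + coordVec t.1 x (t.2 x)))| ≤ ε}) ≤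
        ENNReal.ofReal (C * (ε / ‖p‖) ^ (1 / N : ℝ)) := by
    intro t ht
    obtain ⟨η, hη, C, hC, hev⟩ := hS t.1 t.2 (hgraph t ht)
    have hcd : ContDiffAt ℝ 1 (fun x => q + coordVec t.1 x (t.2 x)) 0 :=
      contDiffAt_const.add (contDiffAt_id.coordVec _ ((hgraph t ht).1.of_le
        (by norm_cast; omega)))
    obtain ⟨K, s, hs, hlip⟩ := hcd.exists_lipschitzOnWith
    obtain ⟨η', hη', hball⟩ := Metric.mem_nhds_iff.1 hs
    refine ⟨min η η', lt_min hη hη', (K + 1) * C, by positivity, ?_⟩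
    filter_upwards [hev] with p hp hp0 ε hε
    have hsub : {x | x ∈ Set.Ioo (-min η η') (min η η') ∧
        |E (p + (q + coordVec t.1 x (t.2 x)))| ≤ ε} ⊆ s := fun x hx => hball (by
      rw [mem_ball_zero_iff, Real.norm_eq_abs, abs_lt]
      exact ⟨(neg_le_neg (min_le_right _ _)).trans_lt hx.1.1,
        hx.1.2.trans_le (min_le_right _ _)⟩)
    refine ((hlip.mono hsub).hausdorffMeasure_image_le zero_le_one).trans ?_
    rw [hausdorffMeasure_real, ENNReal.rpow_one, mul_assoc,
      ENNReal.ofReal_mul (by positivity : (0 : ℝ) ≤ K + 1)]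
    refine mul_le_mul' ?_ ((measure_mono ?_).trans (hp hp0 ε hε))
    · rw [← ENNReal.ofReal_coe_nnreal]
      exact ENNReal.ofReal_le_ofReal (by linarith)
    · exact fun x hx => ⟨⟨(neg_le_neg (min_le_left _ _)).trans_lt hx.1.1,
          hx.1.2.trans_le (min_le_left _ _)⟩, hx.2⟩
  choose! η hη C hC hev using hloc
  -- The summand 1 keeps the constant positive if there are no graphs. The point `q` itself has
  -- length zero.
  refine ⟨_, hcov η hη, 1 + ∑ t ∈ hT.toFinset, C t, ?_, ?_⟩
  · have : 0 ≤ ∑ t ∈ hT.toFinset, C t :=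
      Finset.sum_nonneg fun t ht => (hC t (hT.mem_toFinset.1 ht)).le
    linarith
  filter_upwards [(eventually_all_finite hT).2 hev] with p hp hp0 ε hε
  have hX : 0 ≤ (ε / ‖p‖) ^ (1 / N : ℝ) := by positivity
  calc μH[1] {k : Plane | (k ∈ fermiCurve e ∧ |E (p + k)| ≤ ε) ∧ (k ∈ fermiCurve e → k = q ∨
        ∃ t ∈ T, ∃ x ∈ Set.Ioo (-η t) (η t), k = q + coordVec t.1 x (t.2 x))}
      ≤ μH[1] ({q} ∪ ⋃ t ∈ hT.toFinset, (fun x => q + coordVec t.1 x (t.2 x)) ''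
        {x | x ∈ Set.Ioo (-η t) (η t) ∧ |E (p + (q + coordVec t.1 x (t.2 x)))| ≤ ε}) := by
        refine measure_mono ?_
        rintro k ⟨⟨hk, hkε⟩, hcov⟩
        rcases hcov hk with rfl | ⟨t, ht, x, hx, rfl⟩
        · exact Or.inl rfl
        · exact Or.inr (Set.mem_biUnion (by simpa using ht) ⟨x, ⟨hx, hkε⟩, rfl⟩)
    _ ≤ 0 + ∑ t ∈ hT.toFinset, ENNReal.ofReal (C t * (ε / ‖p‖) ^ (1 / N : ℝ)) := by
        refine (measure_union_le _ _).trans (add_le_add (le_of_eq ?_) ?_)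
        · have := nullSingletonClass_hausdorff Plane one_pos
          exact measure_singleton q
        · exact (measure_biUnion_finset_le _ _).trans
            (Finset.sum_le_sum fun t ht => hp t (hT.mem_toFinset.1 ht) hp0 ε hε)
    _ ≤ _ := by
        rw [zero_add, ← ENNReal.ofReal_sum_of_nonneg fun t ht =>
          mul_nonneg (hC t (hT.mem_toFinset.1 ht)).le hX, ← Finset.sum_mul]
        exact ENNReal.ofReal_le_ofReal (mul_le_mul_of_nonneg_right (by linarith) hX)

-- Two compactness arguments: over pieces of `F` the lengths add, hence sums of constants; over
-- regions of `p` each `p` needs only one estimate, hence maxima.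
open Filter MeasureTheory Measure in
theorem exists_uniform_length_bound {e E : Plane → ℝ} {N : ℕ} {K : Set Plane} (hK : IsCompact K)
    (hF : IsCompact (fermiCurve e))
    (hloc : ∀ p₀ ∈ K, ∀ q ∈ fermiCurve e, ∃ U ∈ 𝓝 q, ∃ C > 0, ∀ᶠ p in 𝓝 p₀, p ≠ 0 → ∀ ε > 0,
      μH[1] {k : Plane | (k ∈ fermiCurve e ∧ |E (p + k)| ≤ ε) ∧ k ∈ U} ≤
        ENNReal.ofReal (C * (ε / ‖p‖) ^ (1 / N : ℝ))) :
    ∃ C > 0, ∀ p ∈ K, p ≠ 0 → ∀ ε > 0,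
      μH[1] {k : Plane | k ∈ fermiCurve e ∧ |E (p + k)| ≤ ε} ≤
        ENNReal.ofReal (C * (ε / ‖p‖) ^ (1 / N : ℝ)) := by
  refine hK.induction_on (p := fun S => ∃ C > 0, ∀ p ∈ S, p ≠ 0 → ∀ ε > 0,
      μH[1] {k : Plane | k ∈ fermiCurve e ∧ |E (p + k)| ≤ ε} ≤
        ENNReal.ofReal (C * (ε / ‖p‖) ^ (1 / N : ℝ))) ?_ ?_ ?_ ?_
  · exact ⟨1, one_pos, by simp⟩
  · rintro s t hst ⟨C, hC, h⟩
    exact ⟨C, hC, fun p hp => h p (hst hp)⟩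
  · rintro s t ⟨C, hC, h⟩ ⟨C', hC', h'⟩
    refine ⟨max C C', lt_max_of_lt_left hC, fun p hp hp0 ε hε => ?_⟩
    have hX : 0 ≤ (ε / ‖p‖) ^ (1 / N : ℝ) := by positivity
    rcases hp with hp | hp
    · exact (h p hp hp0 ε hε).trans
        (ENNReal.ofReal_le_ofReal (mul_le_mul_of_nonneg_right (le_max_left _ _) hX))
    · exact (h' p hp hp0 ε hε).trans
        (ENNReal.ofReal_le_ofReal (mul_le_mul_of_nonneg_right (le_max_right _ _) hX))
  intro p₀ hp₀
  have key : ∃ C > 0, ∀ᶠ p in 𝓝 p₀, p ≠ 0 → ∀ ε > 0,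
      μH[1] {k : Plane | (k ∈ fermiCurve e ∧ |E (p + k)| ≤ ε) ∧ k ∈ fermiCurve e} ≤
        ENNReal.ofReal (C * (ε / ‖p‖) ^ (1 / N : ℝ)) := by
    refine hF.induction_on (p := fun S => ∃ C > 0, ∀ᶠ p in 𝓝 p₀, p ≠ 0 → ∀ ε > 0,
      μH[1] {k : Plane | (k ∈ fermiCurve e ∧ |E (p + k)| ≤ ε) ∧ k ∈ S} ≤
        ENNReal.ofReal (C * (ε / ‖p‖) ^ (1 / N : ℝ))) ?_ ?_ ?_ ?_
    · exact ⟨1, one_pos, by simp⟩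
    · rintro s t hst ⟨C, hC, h⟩
      refine ⟨C, hC, h.mono fun p hp hp0 ε hε => (measure_mono ?_).trans (hp hp0 ε hε)⟩
      exact fun k hk => ⟨hk.1, hst hk.2⟩
    · rintro s t ⟨C, hC, h⟩ ⟨C', hC', h'⟩
      refine ⟨C + C', by positivity, ?_⟩
      filter_upwards [h, h'] with p hp hp' hp0 ε hε
      have hX : 0 ≤ (ε / ‖p‖) ^ (1 / N : ℝ) := by positivity
      rw [add_mul, ENNReal.ofReal_add (by positivity) (by positivity)]
      refine le_trans ?_ (add_le_add (hp hp0 ε hε) (hp' hp0 ε hε))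
      refine (measure_mono ?_).trans (measure_union_le _ _)
      exact fun k hk => hk.2.elim (fun h => Or.inl ⟨hk.1, h⟩) fun h => Or.inr ⟨hk.1, h⟩
    · intro q hq
      obtain ⟨U, hU, h⟩ := hloc p₀ hp₀ q hq
      exact ⟨U, nhdsWithin_le_nhds hU, h⟩
  obtain ⟨C, hC, hev⟩ := key
  refine ⟨_, nhdsWithin_le_nhds hev, C, hC, fun p hp hp0 ε hε => ?_⟩
  refine le_trans (measure_mono ?_) (hp hp0 ε hε)
  exact fun k hk => ⟨hk, hk.1⟩

/-! ### The length bound from nonflatness and nonnesting -/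

theorem isLeast_sInf_nonvanishingOrders {r a : ℕ} {h : ℝ → ℝ}
    (hne : (nonvanishingOrders r a h).Nonempty) :
    IsLeast (nonvanishingOrders r a h) (sInf (nonvanishingOrders r a h)) :=
  ⟨Nat.sInf_mem hne, fun _ hm => Nat.sInf_le hm⟩

theorem bddAbove_orders (e : Plane → ℝ) (r : ℕ) :
    BddAbove (flatnessOrders e r ∪ nestingOrders e r) := by
  refine ⟨r - 2, ?_⟩
  rintro m (⟨f, _, hm⟩ | ⟨f, g, _, hm⟩)
  · exact hm.1.2.1
  · exact hm.1.2.1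

theorem exists_flatness_order {e : Plane → ℝ} {r : ℕ} (h5 : HypH5 e r) {f : ℝ → ℝ}
    (hf : IsFermiGraph e r f) :
    ∃ m, 2 ≤ m ∧ m + 1 ≤ flatNestIndex e r ∧ iteratedDeriv m f 0 ≠ 0 := by
  have hl := isLeast_sInf_nonvanishingOrders (h5 f hf)
  exact ⟨_, hl.1.1, Nat.succ_le_succ (le_csSup (bddAbove_orders e r) (Or.inl ⟨f, hf, hl⟩)),
    hl.1.2.2⟩

theorem exists_nesting_order {e : Plane → ℝ} {r : ℕ} (h6 : HypH6 e r) {f g : ℝ → ℝ}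
    (hfg : IsNestingPair e r f g) :
    ∃ m, m + 1 ≤ flatNestIndex e r ∧ iteratedDeriv m (fun x => f x - g x) 0 ≠ 0 := by
  have hl := isLeast_sInf_nonvanishingOrders (h6 f g hfg)
  exact ⟨_, Nat.succ_le_succ (le_csSup (bddAbove_orders e r) (Or.inr ⟨f, g, hfg, hl⟩)),
    hl.1.2.2⟩

theorem isCompact_fermiCurve {e : Plane → ℝ} (h1 : HypH1 e) (he : Continuous e) :
    IsCompact (fermiCurve e) := by
  refine h1.of_isClosed_subset (isClosed_eq he continuous_const) fun k hk => ?_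
  change |e k| ≤ 1
  rw [show e k = 0 from hk]
  simp

theorem sublevelBound_of_nonnesting {E : Plane → ℝ} {n N : ℕ} (hN : 2 ≤ N) (hNn : N ≤ n)
    (hE : ContDiff ℝ n E) {p₀ q : Plane} {i : Fin 2} {f : ℝ → ℝ} (hf : ContDiffAt ℝ n f 0)
    (hf0 : f 0 = 0) (hB : E (p₀ + q) = 0 → HasBlowup E n (p₀ + q) i)
    (hnest : E (p₀ + q) = 0 → ∀ g, ContDiffAt ℝ n g 0 → g 0 = 0 →
      (∀ᶠ x in 𝓝 0, E (p₀ + q + coordVec i x (g x)) = 0) →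
      ∃ m, m + 1 ≤ N ∧ iteratedDeriv m (fun x => f x - g x) 0 ≠ 0) :
    SublevelBound E N p₀ fun x => q + coordVec i x (f x) := by
  have hle : (N : WithTop ℕ∞) ≤ n := by exact_mod_cast hNn
  refine sublevelBound_of_iteratedDeriv_ne_zero (by omega) (hE.of_le hle)
    (contDiffAt_const.add (contDiffAt_id.coordVec i (hf.of_le hle))) ?_
  by_cases h0 : E (p₀ + q) = 0
  · simpa only [add_assoc, id_eq] using
      exists_iteratedDeriv_ne_zero_of_hasBlowup hE (hB h0) hf hf0 hN hNn (hnest h0)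
  · exact ⟨0, Nat.zero_le _, by simpa [hf0, coordVec_zero] using h0⟩

open MeasureTheory Measure in
theorem exists_length_bound {e : Plane → ℝ} {r : ℕ} (h1 : HypH1 e) (h2 : HypH2 e r) (h4 : HypH4 e)
    (h5 : HypH5 e r) (h6 : HypH6 e r) (hr : 2 * flatNestIndex e r + 1 ≤ r) {K : Set Plane}
    (hK : IsCompact K) :
    ∃ C > 0, ∀ p ∈ K, p ≠ 0 → ∀ ε > 0, μH[1] {k : Plane | k ∈ fermiCurve e ∧ |e (p + k)| ≤ ε} ≤
      ENNReal.ofReal (C * (ε / ‖p‖) ^ (1 / (flatNestIndex e r : ℝ))) := by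
  obtain ⟨h7, he⟩ := h2
  have hn : r - 2 ≠ 0 := by omega
  have he2 : ContDiff ℝ (r - 2 + 2 : ℕ) e := by rwa [Nat.sub_add_cancel (by omega)]
  have heB : ∀ q ∈ fermiCurve e, ∀ i, HasBlowup e (r - 2) q i := fun q hq i =>
    hasBlowup_of_mem_fermiCurve hn he2 h4 hq i
  refine exists_uniform_length_bound hK (isCompact_fermiCurve h1 he.continuous)
    fun p₀ _ q hq => exists_local_length_bound hn (heB q hq) fun i f hf => ?_
  -- Besides nonflatness for `p₀ = 0`, this yields `n₀ ≥ 3`, so the requirement `2 ≤ N` of the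
  -- nonnesting case holds.
  obtain ⟨m, hm2, hmN, hm⟩ := exists_flatness_order h5 ⟨q, hq, i, hf⟩
  have hNn : flatNestIndex e r ≤ r - 2 := by omega
  rcases eq_or_ne p₀ 0 with rfl | hp₀
  · have hle : (flatNestIndex e r : WithTop ℕ∞) ≤ (r - 2 : ℕ) := by exact_mod_cast hNn
    refine sublevelBound_zero (by omega) (he.of_le (by norm_cast; omega))
      (contDiffAt_const.add (contDiffAt_id.coordVec i (hf.1.of_le hle))) hf.2.2 fun w hw => ?_
    exact exists_iteratedDeriv_fderiv_ne_zero_of_hasBlowup (he2.of_le (by norm_cast; omega))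
      (heB q hq i) hf.1 hf.2.1 hf.2.2 hNn ⟨m, hm2, hmN, hm⟩ hw
  · refine sublevelBound_of_nonnesting (by omega) hNn (he.of_le (by norm_cast; omega)) hf.1 hf.2.1
      (fun h => heB _ h i) fun h g hg hg0 hgz => exists_nesting_order h6 (Or.inl ?_)
    exact ⟨q, hq, p₀ + q, h, by simpa using hp₀, i, hf, hg, hg0, hgz⟩

-- The zero set of `E` is `-F`. For `e` not even, H6 also compares `F` and `-F` at coinciding
-- points, so `p₀ = 0` needs no separate argument.
open MeasureTheory Measure in
theorem exists_length_bound_neg {e : Plane → ℝ} {r : ℕ} (h1 : HypH1 e) (h2 : HypH2 e r)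
    (h4 : HypH4 e) (h5 : HypH5 e r) (h6 : HypH6 e r) (hr : 2 * flatNestIndex e r + 1 ≤ r)
    (hodd : ¬ Function.Even e) {E : Plane → ℝ} (hEe : E = fun k => e (-k)) {K : Set Plane}
    (hK : IsCompact K) :
    ∃ C > 0, ∀ p ∈ K, p ≠ 0 → ∀ ε > 0,
      μH[1] {k : Plane | k ∈ fermiCurve e ∧ |E (p + k)| ≤ ε} ≤
        ENNReal.ofReal (C * (ε / ‖p‖) ^ (1 / (flatNestIndex e r : ℝ))) := by
  obtain ⟨h7, he⟩ := h2
  have hn : r - 2 ≠ 0 := by omega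
  have he2 : ContDiff ℝ (r - 2 + 2 : ℕ) e := by rwa [Nat.sub_add_cancel (by omega)]
  have heB : ∀ q ∈ fermiCurve e, ∀ i, HasBlowup e (r - 2) q i := fun q hq i =>
    hasBlowup_of_mem_fermiCurve hn he2 h4 hq i
  have hE : ContDiff ℝ (r - 2 : ℕ) E :=
    hEe ▸ (he.of_le (by norm_cast; omega)).comp contDiff_neg
  have hEz : ∀ k, E k = 0 ↔ -k ∈ fermiCurve e := fun k => by rw [hEe]; rfl
  have hEB : ∀ q, E q = 0 → ∀ i, HasBlowup E (r - 2) q i := fun q hq i =>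
    hEe ▸ (heB (-q) ((hEz q).1 hq) i).comp_neg hn
  refine exists_uniform_length_bound hK (isCompact_fermiCurve h1 he.continuous)
    fun p₀ _ q hq => exists_local_length_bound hn (heB q hq) fun i f hf => ?_
  obtain ⟨m, hm2, hmN, hm⟩ := exists_flatness_order h5 ⟨q, hq, i, hf⟩
  refine sublevelBound_of_nonnesting (by omega) (by omega) hE hf.1 hf.2.1
    (fun h => hEB _ h i) fun h g hg hg0 hgz => exists_nesting_order h6 (Or.inr ?_)
  exact ⟨hodd, q, hq, p₀ + q, (hEz _).1 h, i, hf, hg, hg0, hgz.mono fun x hx => (hEz _).1 hx⟩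

open MeasureTheory Measure in
theorem exists_length_bound_sign {e : Plane → ℝ} {r : ℕ} (h1 : HypH1 e) (h2 : HypH2 e r)
    (h4 : HypH4 e) (h5 : HypH5 e r) (h6 : HypH6 e r) (hr : 2 * flatNestIndex e r + 1 ≤ r) (R : ℝ) :
    ∃ C > 0, ∀ s : ℝ, s = 1 ∨ s = -1 → ∀ p : Plane, ‖p‖ ≤ R → p ≠ 0 → ∀ ε > 0,
      μH[1] {k : Plane | k ∈ fermiCurve e ∧ |e (p + s • k)| ≤ ε} ≤
        ENNReal.ofReal (C * (ε / ‖p‖) ^ (1 / (flatNestIndex e r : ℝ))) := by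
  have hK := isCompact_closedBall (0 : Plane) R
  obtain ⟨C, hC, hb⟩ := exists_length_bound h1 h2 h4 h5 h6 hr hK
  obtain ⟨C', hC', hb'⟩ : ∃ C > 0, ∀ p ∈ Metric.closedBall (0 : Plane) R, p ≠ 0 → ∀ ε > 0,
      μH[1] {k : Plane | k ∈ fermiCurve e ∧ |e (-(p + k))| ≤ ε} ≤
        ENNReal.ofReal (C * (ε / ‖p‖) ^ (1 / (flatNestIndex e r : ℝ))) := by
    by_cases heven : Function.Even e
    · exact ⟨C, hC, by simpa only [heven _] using hb⟩
    · exact exists_length_bound_neg h1 h2 h4 h5 h6 hr heven rfl hK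
  refine ⟨max C C', lt_max_of_lt_left hC, ?_⟩
  intro s hs p hp hp0 ε hε
  have hX : 0 ≤ (ε / ‖p‖) ^ (1 / (flatNestIndex e r : ℝ)) := by positivity
  rcases hs with rfl | rfl
  · simp only [one_smul]
    exact (hb p (by simpa using hp) hp0 ε hε).trans
      (ENNReal.ofReal_le_ofReal (mul_le_mul_of_nonneg_right (le_max_left _ _) hX))
  -- `e (p - k) = e (-(-p + k))`, and `-p` has the same norm as `p`.
  · have := hb' (-p) (by simpa using hp) (neg_ne_zero.2 hp0) ε hε
    simp only [neg_add, neg_neg, norm_neg] at this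
    simp only [neg_smul, one_smul]
    exact this.trans
      (ENNReal.ofReal_le_ofReal (mul_le_mul_of_nonneg_right (le_max_right _ _) hX))

/-! ### The exceptional set lies in a small disc -/

theorem mainTheorem2 (e : Plane → ℝ) (r : ℕ)
    (h1 : HypH1 e) (h2 : HypH2 e r) (h3 : HypH3 e) (h4 : HypH4 e) (h5 : HypH5 e r)
    (h6 : HypH6 e r) (hr : 2 * flatNestIndex e r + 1 ≤ r) (M : ℝ) (hM : 1 < M) :
    ∃ D : ℝ, 0 < D ∧ ∀ δ : ℝ, 0 < δ → δ < 1 → ∀ s : ℝ, s = 1 ∨ s = -1 →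
      MeasureTheory.volume {p : Plane | ∃ j : ℝ, j < 0 ∧
        ENNReal.ofReal ((M ^ j / δ) ^ (1 / (flatNestIndex e r : ℝ))) ≤
          MeasureTheory.Measure.hausdorffMeasure 1
            {k : Plane | k ∈ fermiCurve e ∧ |e (p + s • k)| ≤ M ^ j}} ≤
      ENNReal.ofReal (D * δ ^ 2) := by
  obtain ⟨R, hR⟩ := h1.isBounded.subset_closedBall 0
  have hR' : ∀ k : Plane, |e k| ≤ 1 → ‖k‖ ≤ R := fun k hk => by simpa using hR hk
  obtain ⟨C, hC, hb⟩ := exists_length_bound_sign h1 h2 h4 h5 h6 hr (R + R)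
  set N := flatNestIndex e r with hN
  have hN0 : N ≠ 0 := Nat.succ_ne_zero _
  refine ⟨Real.pi * (C ^ N) ^ 2, by positivity, fun δ hδ _ s hs => ?_⟩
  refine (MeasureTheory.measure_mono (t := Metric.closedBall 0 (C ^ N * δ)) ?_).trans ?_
  · rintro p ⟨j, hj, hle⟩
    rw [mem_closedBall_zero_iff]
    rcases eq_or_ne p 0 with rfl | hp0
    · rw [norm_zero]; positivity
    have hM0 : 0 < M := by linarith
    have hε : 0 < M ^ j := Real.rpow_pos_of_pos hM0 j
    have hε1 : M ^ j ≤ 1 := (Real.rpow_lt_one_of_one_lt_of_neg hM hj).le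
    have hpos : 0 < ‖p‖ := norm_pos_iff.2 hp0
    -- For larger `p`, the points `k` and `p + s • k` cannot both lie in the disc containing `{|e| ≤
    -- 1}`; the set of `k` is then empty, while the assumed lower bound on its length is positive.
    have hpR : ‖p‖ ≤ R + R := by
      by_contra hcon
      rw [Set.eq_empty_of_forall_notMem (s := {k : Plane | k ∈ fermiCurve e ∧ _})] at hle
      · rw [MeasureTheory.measure_empty, nonpos_iff_eq_zero, ENNReal.ofReal_eq_zero] at hle
        exact absurd hle (not_le.2 (by positivity))
      · rintro k ⟨hk, hke⟩
        have hk1 := hR' k (by rw [show e k = 0 from hk]; simp)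
        have hk2 := hR' _ (hke.trans hε1)
        have hs1 : ‖s • k‖ = ‖k‖ := by rcases hs with rfl | rfl <;> simp
        have := norm_sub_le (p + s • k) (s • k)
        rw [add_sub_cancel_right, hs1] at this
        linarith
    have h := hle.trans (hb s hs p hpR hp0 _ hε)
    rw [ENNReal.ofReal_le_ofReal_iff (by positivity)] at h
    -- With `C` written as an `N`-th root, both sides are `1/N`-th powers and their bases can be
    -- compared; `M ^ j` then cancels.
    have hCN : C = (C ^ N) ^ (1 / (N : ℝ)) := by
      rw [one_div, Real.pow_rpow_inv_natCast hC.le hN0]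
    rw [hCN, ← Real.mul_rpow (by positivity) (by positivity),
      Real.rpow_le_rpow_iff (by positivity) (by positivity) (by positivity),
      ← mul_div_assoc, div_le_div_iff₀ hδ hpos] at h
    have h' : M ^ j * ‖p‖ ≤ M ^ j * (C ^ N * δ) := by linarith
    exact le_of_mul_le_mul_left h' hε
  · rw [EuclideanSpace.volume_closedBall_fin_two, ← ENNReal.ofReal_pow (by positivity),
      ← ENNReal.ofReal_mul (by positivity)]
    exact ENNReal.ofReal_le_ofReal (le_of_eq (by ring))
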